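/- Let $M$ be an infinite field of characteristic $\neq 2$ with algebraic closure $\overline M$, and let $f(X)=X^4+aX^2+b$ and $f'(X)=X^4+a'X^2+b'$ ($a,b,a',b'\in M$) be separable and irreducible over $M$. Let $L,L'\subset\overline M$ be their splitting fields over $M$ and $G,G',H$ the Galois groups over $M$ of $f$, $f'$ and $ff'$, and assume $\#G\ge\#G'$. Order the roots as $(\alpha_1,\alpha_2,\alpha_3,\alpha_4)=(\alpha_1,\alpha_2,-\alpha_1,-\alpha_2)$ for $f$ and $(\beta_1,\beta_2,\beta_3,\beta_4)=(\beta_1,\beta_2,-\beta_1,-\beta_2)$ for $f'$. *Resolvents and decomposition types.* Put $P=x_1y_1+x_2y_2+x_3y_3+x_4y_4$ and $D_4=\langle(1234),(13)\rangle\le S_4$. For $\Gamma=D_4$ or $\Gamma=S_4$, let $\Gamma\times\Gamma$ act on polynomials in the $x_i,y_i$ by letting the first factor permute the $x_i$ and the second the $y_i$, and for $u,v\in\overline M^4$ put $$R_\Gamma(u,v;X)=\prod_{\Theta}\bigl(X-\Theta(u,v)\bigr),$$ where $\Theta$ runs over the orbit of $P$ under $\Gamma\times\Gamma$. The degree-8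 resolvent $\mathcal R^1$ of $(f,f')$ is $R_{D_4}(\alpha,\beta;X)$, and the degree-24 resolvent $\mathcal R$ is $R_{S_4}(\alpha,\beta;X)$. The decomposition type $\mathrm{DT}$ of $\mathcal R^1$ (of $\mathcal R$) over $M$ is the multiset of degrees of the irreducible factors over $M$ of $R_\Gamma\bigl((p(\alpha_i))_i,(q(\beta_i))_i;X\bigr)$, with $\Gamma=D_4$ (with $\Gamma=S_4$), where $p,q\in M[X]$ have degree $\le3$, the $p(\alpha_i)$ are pairwise distinct, the $q(\beta_i)$ are pairwise distinct, and this polynomial lies in $M[X]$ and has no repeated factors. Such $p,q$ exist in both cases, and the decomposition types do not depend on their choice. *Claim.* $G$ is isomorphic to $D_4$, $C_4$ or $V_4$. If $G\cong D_4$ (if $G\cong C_4$ or $G\cong V_4$), then the data $G$, $G'$, $H$, $L\cap L'$, $\mathrm{DT}(\mathcal R^1)$, $\mathrm{DT}(\mathcal R)$ are those of one of the rows of Table 3 (of Table 4), the groups being given up to isomorphism. In the tables a number $n$ in the column $[L\cap L':M]$ means $[L\cap L':M]=n$; so $1$ means $L\cap L'=M$. An exponent on an entry of a decomposition type is a multiplicity.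 The semidirect products are: $\Gamma_{32,27}=(V_4\times V_4)\rtimes C_2$, where $C_2$ exchanges the two factors $C_2$ of each $V_4=C_2\times C_2$; $\Gamma_{32,28}=(C_4\times V_4)\rtimes C_2$, where $C_2$ inverts $C_4$ and exchanges the two factors of $V_4$; $\Gamma_{32,34}=(C_4\times C_4)\rtimes C_2$, where $C_2$ acts by inversion; $\Gamma_{16,3}=(C_4\times C_2)\rtimes C_2$, where the acting involution sends $(x,y)$ to $(x,\,y+(x\bmod 2))$ in additive notation; $\Gamma_{16,4}=C_4\rtimes C_4$, where a generator of the second factor inverts the first. (The indices are the identifiers in the GAP small groups library.) Table 3 ($G\cong D_4$) | $G'$ | $H$ | $L\cap L'$ or $[L\cap L':M]$ | $\mathrm{DT}(\mathcal R^1)$ | $\mathrm{DT}(\mathcal R)$ | |---|---|---|---|---| | $D_4$ | $D_4\times D_4$ | $1$ | $8$ | $16,8$ | | $D_4$ | $\Gamma_{32,27}$ | $2$ | $8$ | $16,8$ | | $D_4$ | $\Gamma_{32,27}$ | $2$ | $4,4$ | $16,4,4$ | | $D_4$ | $\Gamma_{32,27}$ | $2$ | $4,4$ | $8,8,4,4$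 | | $D_4$ | $\Gamma_{32,28}$ | $2$ | $8$ | $16,8$ | | $D_4$ | $\Gamma_{32,34}$ | $2$ | $4,4$ | $16,4,4$ | | $D_4$ | $\Gamma_{16,3}$ | $4$ | $8$ | $16,8$ | | $D_4$ | $\Gamma_{16,3}$ | $4$ | $4,4$ | $16,4,4$ | | $D_4$ | $\Gamma_{16,3}$ | $4$ | $4,4$ | $8,8,4,4$ | | $D_4$ | $D_4\times C_2$ | $4$ | $4,4$ | $16,4,4$ | | $D_4$ | $D_4\times C_2$ | $4$ | $2^4$ | $8^2,2^4$ | | $D_4$ | $D_4$ | $L=L'$ | $4,2,2$ | $8,8,4,2,2$ | | $D_4$ | $D_4$ | $L=L'$ | $2^3,1^2$ | $8,4^2,2^3,1^2$ | | $C_4$ | $D_4\times C_4$ | $1$ | $8$ | $16,8$ | | $C_4$ | $\Gamma_{16,3}$ | $2$ | $4,4$ | $16,4,4$ | | $C_4$ | $\Gamma_{16,3}$ | $2$ | $4,4$ | $8,8,4,4$ | | $C_4$ | $\Gamma_{16,4}$ | $2$ | $8$ | $16,8$ | | $V_4$ | $D_4\times V_4$ | $1$ | $8$ | $8,8,8$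 | | $V_4$ | $D_4\times C_2$ | $2$ | $8$ | $8,8,8$ | | $V_4$ | $D_4\times C_2$ | $2$ | $8$ | $8,8,4,4$ | | $V_4$ | $D_4\times C_2$ | $2$ | $4,4$ | $8,8,4,4$ | | $V_4$ | $D_4$ | $L\supsetneq L'$ | $8$ | $8,4^4$ | | $V_4$ | $D_4$ | $L\supsetneq L'$ | $4,4$ | $8,4^4$ | Table 4 ($G\cong C_4$ or $G\cong V_4$) | $G$ | $G'$ | $H$ | $L\cap L'$ or $[L\cap L':M]$ | $\mathrm{DT}(\mathcal R^1)$ | $\mathrm{DT}(\mathcal R)$ | |---|---|---|---|---|---| | $C_4$ | $C_4$ | $C_4\times C_4$ | $1$ | $4,4$ | $16,4,4$ | | $C_4$ | $C_4$ | $C_4\times C_2$ | $2$ | $2^4$ | $8^2,2^4$ | | $C_4$ | $C_4$ | $C_4$ | $L=L'$ | $2^2,1^4$ | $4^4,2^2,1^4$ | | $C_4$ | $V_4$ | $C_4\times V_4$ | $1$ | $8$ | $8,8,8$ | | $C_4$ | $V_4$ | $C_4\times C_2$ | $2$ | $8$ | $8,8,4,4$ | | $C_4$ | $V_4$ | $C_4\times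 C_2$ | $2$ | $4,4$ | $8,8,4,4$ | | $V_4$ | $C_4$ | $V_4\times C_4$ | $1$ | $8$ | $8,8,8$ | | $V_4$ | $C_4$ | $C_2\times C_4$ | $2$ | $8$ | $8,8,4,4$ | | $V_4$ | $C_4$ | $C_2\times C_4$ | $2$ | $4,4$ | $8,8,4,4$ | | $V_4$ | $V_4$ | $V_4\times V_4$ | $1$ | $4,4$ | $4^6$ | | $V_4$ | $V_4$ | $V_4\times C_2$ | $2$ | $4,4$ | $4^4,2^4$ | | $V_4$ | $V_4$ | $V_4\times C_2$ | $2$ | $4,2,2$ | $4^4,2^4$ | | $V_4$ | $V_4$ | $V_4\times C_2$ | $2$ | $2^4$ | $4^4,2^4$ | | $V_4$ | $V_4$ | $V_4$ | $L=L'$ | $4,2,2$ | $4^2,2^6,1^4$ | | $V_4$ | $V_4$ | $V_4$ | $L=L'$ | $2^2,1^4$ | $4^2,2^6,1^4$ | -/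

import Mathlib

open Polynomial

noncomputable section

namespace QuarticInt

/-! ### Resolvents and decomposition types -/

section Resolvent

/-- The orbit `{π(Θ) : π ∈ G}` of a polynomial `Θ` in the variables `x_i` under a group `G` of
permutations of the variables, `π` acting by `x_i ↦ x_{π(i)}`.  It is in bijection with the cosets
`G / H`, where `H` is the stabilizer of `Θ` in `G`. -/
def permOrbit {K ι : Type*} [Field K] [Fintype ι] (G : Subgroup (Equiv.Perm ι))
    (Θ : MvPolynomial ι K) : Finset (MvPolynomial ι K) := by
  classical
  exact (Finset.univ.filter (fun π : Equiv.Perm ι => π ∈ G)).image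
    (fun π => MvPolynomial.rename π Θ)

/-- The `G`-relative `H`-invariant resolvent by `Θ` (with `H = Stab_G(Θ)`) of the polynomial with
the ordered tuple of roots `α`: the product of `X - ω(π(Θ))` over the cosets `π H` in `G / H`,
where `ω` is the evaluation `x_i ↦ α_i`. -/
def resolvent {K Ω ι : Type*} [Field K] [Field Ω] [Algebra K Ω] [Fintype ι]
    (G : Subgroup (Equiv.Perm ι)) (Θ : MvPolynomial ι K) (α : ι → Ω) : Polynomial Ω :=
  ∏ Ξ ∈ permOrbit G Θ, (X - C (MvPolynomial.aeval α Ξ))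

/-- The partition of `deg R` formed by the degrees of the irreducible factors of `R` over `K`. -/
def factorDegrees {K : Type*} [Field K] (R : K[X]) : Multiset ℕ :=
  (UniqueFactorizationMonoid.factors R).map natDegree

/-- `P = x₁y₁ + x₂y₂ + x₃y₃ + x₄y₄`. -/
def invariantP (K : Type*) [Field K] : MvPolynomial (Fin 4 ⊕ Fin 4) K :=
  ∑ i : Fin 4, MvPolynomial.X (Sum.inl i) * MvPolynomial.X (Sum.inr i)

/-- For `G ≤ S₄`, the group `G × G'` acting on `x₁,…,x₄,y₁,…,y₄`, where the copy `G'` of `G`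
permutes the `y_i`. -/
def doubled (G : Subgroup (Equiv.Perm (Fin 4))) : Subgroup (Equiv.Perm (Fin 4 ⊕ Fin 4)) :=
  (G.prod G).map (Equiv.Perm.sumCongrHom (Fin 4) (Fin 4))

/-- The dihedral group `⟨(1234), (13)⟩` in `S₄` (with the letters numbered from `0`). -/
def dihedralSubgroup : Subgroup (Equiv.Perm (Fin 4)) :=
  Subgroup.closure {finRotate 4, Equiv.swap 0 2}

/-- `T` is the decomposition type over `M` of the `G × G'`-relative resolvent by `P` of `f · f'`,
where `f`, `f'` are separable quartics with ordered roots `α`, `β`: the partition given by the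
degrees of the irreducible factors over `M` of the same resolvent, with no repeated factors, of some
Tschirnhausen transformations (with roots `p(α_i)` and `q(β_i)`, for `p`, `q` over `M` of degree
at most `3`) of `f` and `f'`. -/
def HasDecompositionType {M Ω : Type*} [Field M] [Field Ω] [Algebra M Ω]
    (G : Subgroup (Equiv.Perm (Fin 4))) (α β : Fin 4 → Ω) (T : Multiset ℕ) : Prop :=
  ∃ p q : M[X], p.natDegree ≤ 3 ∧ q.natDegree ≤ 3 ∧
    Function.Injective (fun i => aeval (α i) p) ∧ Function.Injective (fun i => aeval (β i) q) ∧
    ∃ R : M[X],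
      R.map (algebraMap M Ω) = resolvent (doubled G) (invariantP M)
        (Sum.elim (fun i => aeval (α i) p) (fun i => aeval (β i) q)) ∧
      Squarefree R ∧ factorDegrees R = T

end Resolvent

/-! ### The quartics `X⁴ + aX² + b` -/

section Quartic

/-- `f_{a,b}(X) = X⁴ + aX² + b`. -/
def quartic {M : Type*} [Field M] (a b : M) : M[X] := X ^ 4 + C a * X ^ 2 + C b

/-- `α` lists the roots of `X⁴ + aX² + b`, with multiplicity, as `(α₁, α₂, -α₁, -α₂)`. -/
def IsRootOrdering {M Ω : Type*} [Field M] [Field Ω] [Algebra M Ω] (a b : M)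
    (α : Fin 4 → Ω) : Prop :=
  (quartic a b).map (algebraMap M Ω) = ∏ i, (X - C (α i)) ∧ α 2 = -α 0 ∧ α 3 = -α 1

/-- The splitting field of `f` over `M` inside the algebraic closure of `M`. -/
def splField {M : Type*} [Field M] (f : M[X]) : IntermediateField M (AlgebraicClosure M) :=
  IntermediateField.adjoin M (f.rootSet (AlgebraicClosure M))

end Quartic

/-! ### The groups in the tables -/

section Groups

abbrev C2 : Type := Multiplicative (ZMod 2)
abbrev C4 : Type := Multiplicative (ZMod 4)
abbrev V4 : Type := C2 × C2
abbrev D4 : Type := DihedralGroup 4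

/-- The action of the group of order two through an automorphism `φ` with `φ² = 1`. -/
def involutionAction {N : Type} [Group N] (φ : MulAut N) (h : φ * φ = 1) : C2 →* MulAut N where
  toFun x := if x = 1 then 1 else φ
  map_one' := by simp
  map_mul' x y := by
    have key : ∀ z : C2, z = 1 ∨ z = Multiplicative.ofAdd 1 := by decide
    have hne : (Multiplicative.ofAdd (1 : ZMod 2) : C2) ≠ 1 := by decide
    have hsq : (Multiplicative.ofAdd (1 : ZMod 2) * Multiplicative.ofAdd 1 : C2) = 1 := by decide
    rcases key x with rfl | rfl <;> rcases key y with rfl | rfl <;> simp [hne, hsq, h]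

/-- The reduction map `C₄ → C₂`. -/
def red : C4 →* C2 := AddMonoidHom.toMultiplicative (ZMod.castHom (by decide : 2 ∣ 4) (ZMod 2)).toAddMonoidHom

/-- Inversion on an abelian group. -/
def invAut (N : Type) [CommGroup N] : MulAut N := MulEquiv.inv N

lemma invAut_sq (N : Type) [CommGroup N] : invAut N * invAut N = 1 := by
  ext x
  simp [invAut]

/-- The exchange of the two factors of `V₄ = C₂ × C₂`. -/
def swapAut : MulAut V4 := MulEquiv.prodComm

lemma swapAut_sq : swapAut * swapAut = 1 := by
  ext x <;> simp [swapAut]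

/-- Automorphisms `φ` of `A` and `ψ` of `B` acting componentwise on `A × B`. -/
def prodAut {A B : Type} [Group A] [Group B] (φ : MulAut A) (ψ : MulAut B) : MulAut (A × B) :=
  MulEquiv.prodCongr φ ψ

lemma prodAut_sq {A B : Type} [Group A] [Group B] (φ : MulAut A) (ψ : MulAut B)
    (hφ : φ * φ = 1) (hψ : ψ * ψ = 1) : prodAut φ ψ * prodAut φ ψ = 1 := by
  ext x
  · exact DFunLike.congr_fun hφ x.1
  · exact DFunLike.congr_fun hψ x.2

/-- The automorphism `(x, y) ↦ (x, y · (x mod 2))` of `C₄ × C₂`. -/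
def shearAut : MulAut (C4 × C2) where
  toFun x := (x.1, x.2 * red x.1)
  invFun x := (x.1, x.2 * red x.1)
  left_inv := by unfold red; intro x; revert x; decide
  right_inv := by unfold red; intro x; revert x; decide
  map_mul' x y := by
    ext
    · rfl
    · simp [mul_mul_mul_comm]

lemma shearAut_sq : shearAut * shearAut = 1 := by
  ext x
  · rfl
  · exact congrArg Prod.snd (shearAut.left_inv x)

/-- `(V₄ × V₄) ⋊ C₂`, small group `[32, 27]`: the involution exchanges the two factors `C₂` of each
`V₄`. -/
abbrev G32n27 : Type :=
  (V4 × V4) ⋊[involutionAction (prodAut swapAut swapAut)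
    (prodAut_sq _ _ swapAut_sq swapAut_sq)] C2

/-- `(C₄ × V₄) ⋊ C₂`, small group `[32, 28]`: the involution inverts `C₄` and exchanges the two
factors `C₂` of `V₄`. -/
abbrev G32n28 : Type :=
  (C4 × V4) ⋊[involutionAction (prodAut (invAut C4) swapAut)
    (prodAut_sq _ _ (invAut_sq C4) swapAut_sq)] C2

/-- `(C₄ × C₄) ⋊ C₂`, small group `[32, 34]`: the involution is inversion. -/
abbrev G32n34 : Type :=
  (C4 × C4) ⋊[involutionAction (prodAut (invAut C4) (invAut C4))
    (prodAut_sq _ _ (invAut_sq C4) (invAut_sq C4))] C2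

/-- `(C₄ × C₂) ⋊ C₂`, small group `[16, 3]`: the involution fixes `C₂` and multiplies a generator of
`C₄` by the generator of `C₂`. -/
abbrev G16n3 : Type := (C4 × C2) ⋊[involutionAction shearAut shearAut_sq] C2

/-- `C₄ ⋊ C₄`, small group `[16, 4]`: a generator of the second factor inverts the first. -/
abbrev G16n4 : Type := C4 ⋊[(involutionAction (invAut C4) (invAut_sq C4)).comp red] C4

end Groups

/-! ### The tables -/

section Tables

/-- The possible entries of the column on the intersection `L ∩ L'`. -/
inductive Meet where
  /-- `L ∩ L' = M` -/
  | trivial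
  /-- `[L ∩ L' : M] = n` -/
  | degree (n : ℕ)
  /-- `L = L'` -/
  | equal
  /-- `L` properly contains `L'` -/
  | contains

/-- The condition on `L` and `L'` expressed by an entry. -/
def Meet.Holds {M Ω : Type*} [Field M] [Field Ω] [Algebra M Ω] (L L' : IntermediateField M Ω) :
    Meet → Prop
  | .trivial => L ⊓ L' = ⊥
  | .degree n => Module.finrank M (L ⊓ L' : IntermediateField M Ω) = n
  | .equal => L = L'
  | .contains => L' < L

/-- One row of a table for two quartics `f`, `f'` with ordered roots `α`, `β`: the Galois groups of
`f`, `f'`, `f · f'`, the intersection of the two splitting fields, and the decomposition types of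
the degree `8` resolvent (relative to `D₄ × D₄'`) and of the degree `24` resolvent (relative to
`S₄ × S₄'`). -/
def Row {M : Type*} [Field M] (f f' : M[X]) (α β : Fin 4 → AlgebraicClosure M)
    (G G' H : Type) [Group G] [Group G'] [Group H] (m : Meet) (dt₁ dt : Multiset ℕ) : Prop :=
  Nonempty (f.Gal ≃* G) ∧ Nonempty (f'.Gal ≃* G') ∧ Nonempty ((f * f').Gal ≃* H) ∧
    m.Holds (splField f) (splField f') ∧
    (∀ T, HasDecompositionType (M := M) dihedralSubgroup α β T ↔ T = dt₁) ∧
    (∀ T, HasDecompositionType (M := M) ⊤ α β T ↔ T = dt)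

/-- The table for Galois group `D₄` of `f` (23 rows). -/
def TableD4 {M : Type*} [Field M] (f f' : M[X]) (α β : Fin 4 → AlgebraicClosure M) : Prop :=
  Row f f' α β D4 D4 (D4 × D4) .trivial {8} {16, 8} ∨
  Row f f' α β D4 D4 G32n27 (.degree 2) {8} {16, 8} ∨
  Row f f' α β D4 D4 G32n27 (.degree 2) {4, 4} {16, 4, 4} ∨
  Row f f' α β D4 D4 G32n27 (.degree 2) {4, 4} {8, 8, 4, 4} ∨
  Row f f' α β D4 D4 G32n28 (.degree 2) {8} {16, 8} ∨
  Row f f' α β D4 D4 G32n34 (.degree 2) {4, 4} {16, 4, 4} ∨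
  Row f f' α β D4 D4 G16n3 (.degree 4) {8} {16, 8} ∨
  Row f f' α β D4 D4 G16n3 (.degree 4) {4, 4} {16, 4, 4} ∨
  Row f f' α β D4 D4 G16n3 (.degree 4) {4, 4} {8, 8, 4, 4} ∨
  Row f f' α β D4 D4 (D4 × C2) (.degree 4) {4, 4} {16, 4, 4} ∨
  Row f f' α β D4 D4 (D4 × C2) (.degree 4) {2, 2, 2, 2} {8, 8, 2, 2, 2, 2} ∨
  Row f f' α β D4 D4 D4 .equal {4, 2, 2} {8, 8, 4, 2, 2} ∨
  Row f f' α β D4 D4 D4 .equal {2, 2, 2, 1, 1} {8, 4, 4, 2, 2, 2, 1, 1} ∨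
  Row f f' α β D4 C4 (D4 × C4) .trivial {8} {16, 8} ∨
  Row f f' α β D4 C4 G16n3 (.degree 2) {4, 4} {16, 4, 4} ∨
  Row f f' α β D4 C4 G16n3 (.degree 2) {4, 4} {8, 8, 4, 4} ∨
  Row f f' α β D4 C4 G16n4 (.degree 2) {8} {16, 8} ∨
  Row f f' α β D4 V4 (D4 × V4) .trivial {8} {8, 8, 8} ∨
  Row f f' α β D4 V4 (D4 × C2) (.degree 2) {8} {8, 8, 8} ∨
  Row f f' α β D4 V4 (D4 × C2) (.degree 2) {8} {8, 8, 4, 4} ∨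
  Row f f' α β D4 V4 (D4 × C2) (.degree 2) {4, 4} {8, 8, 4, 4} ∨
  Row f f' α β D4 V4 D4 .contains {8} {8, 4, 4, 4, 4} ∨
  Row f f' α β D4 V4 D4 .contains {4, 4} {8, 4, 4, 4, 4}

/-- The table for Galois group `C₄` or `V₄` of `f` (15 rows). -/
def TableC4V4 {M : Type*} [Field M] (f f' : M[X]) (α β : Fin 4 → AlgebraicClosure M) : Prop :=
  Row f f' α β C4 C4 (C4 × C4) .trivial {4, 4} {16, 4, 4} ∨
  Row f f' α β C4 C4 (C4 × C2) (.degree 2) {2, 2, 2, 2} {8, 8, 2, 2, 2, 2} ∨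
  Row f f' α β C4 C4 C4 .equal {2, 2, 1, 1, 1, 1} {4, 4, 4, 4, 2, 2, 1, 1, 1, 1} ∨
  Row f f' α β C4 V4 (C4 × V4) .trivial {8} {8, 8, 8} ∨
  Row f f' α β C4 V4 (C4 × C2) (.degree 2) {8} {8, 8, 4, 4} ∨
  Row f f' α β C4 V4 (C4 × C2) (.degree 2) {4, 4} {8, 8, 4, 4} ∨
  Row f f' α β V4 C4 (V4 × C4) .trivial {8} {8, 8, 8} ∨
  Row f f' α β V4 C4 (C2 × C4) (.degree 2) {8} {8, 8, 4, 4} ∨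
  Row f f' α β V4 C4 (C2 × C4) (.degree 2) {4, 4} {8, 8, 4, 4} ∨
  Row f f' α β V4 V4 (V4 × V4) .trivial {4, 4} {4, 4, 4, 4, 4, 4} ∨
  Row f f' α β V4 V4 (V4 × C2) (.degree 2) {4, 4} {4, 4, 4, 4, 2, 2, 2, 2} ∨
  Row f f' α β V4 V4 (V4 × C2) (.degree 2) {4, 2, 2} {4, 4, 4, 4, 2, 2, 2, 2} ∨
  Row f f' α β V4 V4 (V4 × C2) (.degree 2) {2, 2, 2, 2} {4, 4, 4, 4, 2, 2, 2, 2} ∨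
  Row f f' α β V4 V4 V4 .equal {4, 2, 2} {4, 4, 2, 2, 2, 2, 2, 2, 1, 1, 1, 1} ∨
  Row f f' α β V4 V4 V4 .equal {2, 2, 1, 1, 1, 1} {4, 4, 2, 2, 2, 2, 2, 2, 1, 1, 1, 1}

end Tables

end QuarticInt

end

/-! Every entry of a row is a function of one finite group. A Galois automorphism commutes with
negation, so it permutes the four roots of either quartic inside the symmetry group `D4` of the
square with opposite vertices `±α₁`, `±α₂`. This gives homomorphisms `ρ`, `ρ'` to `D4`.
Irreducibility makes their images transitive, hence equal to the whole group, the rotations or the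
normal four-group of `S₄` (`exists_kind`). Let `S ≤ D4 × D4` be the image of the pair. Its
projections are `G` and `G'`, and `S` itself is `H`. The degree of `L ∩ L'` follows from `#H · [L ∩
L' : M] = #G · #G'` (`finrank_inf_mul_card`).

The decomposition types also depend on `S` alone. The orbit of `P` is indexed by `π ∈ Γ`, with root
`∑ p(α_i) q(β_{π(i)})`, and `σ` carries the root of `π` to that of `ρ'(σ) π ρ(σ)⁻¹`
(`map_sum_aeval`). If the resolvent is squarefree, these roots are distinct, so its irreducible
factors correspond to the orbits of `S` on `Γ` (`hasDecompositionType_iff`). Orbit sizes come from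
stabilizers: that of `c ∈ D4` consists of the pairs `(d, c d c⁻¹)` in `S`; off `D4`, only elements
of the normal four-group can occur as `d`.

What remains is a finite enumeration. As in Goursat's lemma, `S` is determined by its fibre `K` over
the identity and by lifts of two generators of its first projection (`exists_fiberMem`). All such
data are checked by kernel computation (`profiles_dih_dih` and its companions), which compares
order, orbit sizes and, where needed, an explicit isomorphism with the rows of the tables. -/

namespace QuarticInt

open DihedralGroup

/-! ### Subdirect products of transitive groups of degree four -/

section Finite

/-- The three transitive subgroups of the dihedral group of order eight acting on four letters. -/
inductive Kind where
  | dih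
  | cyc
  | klein

/-- Membership in the transitive subgroup. -/
def Kind.mem : Kind → D4 → Bool
  | .dih, _ => true
  | .cyc, r _ => true
  | .cyc, sr _ => false
  | .klein, r i => i == 0 || i == 2
  | .klein, sr i => i == 1 || i == 3

/-- A pair of generators of the transitive subgroup. -/
def Kind.gens : Kind → D4 × D4
  | .dih => (r 1, sr 0)
  | .cyc => (r 1, 1)
  | .klein => (sr 1, sr 3)

/-- The word in `g₁`, `g₂` that expresses an element in the generators. -/
def Kind.word (g₁ g₂ : D4) : Kind → D4 → D4
  | .dih, r i => g₁ ^ i.val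
  | .dih, sr i => g₂ * g₁ ^ i.val
  | .cyc, r i => g₁ ^ i.val
  | .cyc, sr _ => 1
  | .klein, r i => if i = 0 then 1 else g₁ * g₂
  | .klein, sr i => if i = 1 then g₁ else g₂

/-- The elements of the dihedral group. -/
def elts : List D4 := [r 0, r 1, r 2, r 3, sr 0, sr 1, sr 2, sr 3]

/-- The elements of the square of the dihedral group. -/
def pairs : List (D4 × D4) := elts ×ˢ elts

/-- The subgroups of the dihedral group. -/
def subgroupLists : List (List D4) :=
  [[r 0], [r 0, r 2], [r 0, sr 0], [r 0, sr 1], [r 0, sr 2], [r 0, sr 3],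
    [r 0, r 1, r 2, r 3], [r 0, r 2, sr 0, sr 2], [r 0, r 2, sr 1, sr 3], elts]

/-- Representatives of the left cosets of a subgroup. -/
def cosetReps (K : List D4) : List D4 :=
  elts.filter fun g => decide (elts.find? (fun h => decide (g⁻¹ * h ∈ K)) = some g)

/-- Membership in the subgroup of `D₄ × D₄` which projects onto a transitive subgroup, contains
`g₁`, `g₂` above its generators, and has the fibre `K` above the identity. -/
def fiberMem (k : Kind) (K : List D4) (g₁ g₂ : D4) (p : D4 × D4) : Bool :=
  k.mem p.1 && decide ((k.word g₁ g₂ p.1)⁻¹ * p.2 ∈ K)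

/-- The products of `(d, word d)`, with `d` in the transitive subgroup, and `(1, c)`, with `c ∈ K`,
are closed under right multiplication by `g` as a set with indicator function `fiberMem`. -/
def IsClosedUnder (k : Kind) (K : List D4) (g₁ g₂ : D4) (g : D4 × D4) : Prop :=
  ∀ d ∈ elts, k.mem d = true → ∀ c ∈ K,
    fiberMem k K g₁ g₂ ((d, k.word g₁ g₂ d * c) * g) = true

/-- The set with indicator function `m` projects onto the given transitive subgroup. -/
def ProjectsTo (m : D4 × D4 → Bool) (k : Kind) : Prop :=
  ∀ d ∈ elts, (∃ c ∈ elts, m (c, d) = true) ↔ k.mem d = true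

instance (k K g₁ g₂ g) : Decidable (IsClosedUnder k K g₁ g₂ g) := by
  unfold IsClosedUnder; infer_instance
instance (m k) : Decidable (ProjectsTo m k) := by unfold ProjectsTo; infer_instance

/-- The conditions on the parameters of `fiberMem` that hold for a subgroup with projections of
kinds `k` and `k'`. -/
def IsDatum (k k' : Kind) (K : List D4) (g₁ g₂ : D4) : Prop :=
  ProjectsTo (fiberMem k K g₁ g₂) k' ∧ IsClosedUnder k K g₁ g₂ (k.gens.1, g₁) ∧
    IsClosedUnder k K g₁ g₂ (k.gens.2, g₂)

instance (k k' K g₁ g₂) : Decidable (IsDatum k k' K g₁ g₂) := by unfold IsDatum; infer_instance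

/-- The multiset in which every part `n` of `T` is replaced by `n` copies of itself. -/
def expand (T : Multiset ℕ) : Multiset ℕ := T.bind fun n => Multiset.replicate n n

/-- Conjugation by the transposition `(01)` on the transitive four-group. -/
def conjLeft : D4 → D4
  | r i => if i = 0 then r 0 else sr 1
  | sr i => if i = 1 then r 2 else sr 3

/-- Conjugation by the transposition `(03)` on the transitive four-group. -/
def conjRight : D4 → D4
  | r i => if i = 0 then r 0 else sr 3
  | sr i => if i = 3 then r 2 else sr 1

/-- The sizes of the orbits of the elements of `D₄ ≤ S₄`. -/
def innerSizes (m : D4 × D4 → Bool) (n : ℕ) : List ℕ :=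
  elts.map fun c => n / elts.countP fun d => m (d, c * d * c⁻¹)

/-- The sizes of the orbits of the elements of `D₄ w`, where `w` acts on the transitive four-group
as `θ`. -/
def outerSizes (θ : D4 → D4) (m : D4 × D4 → Bool) (n : ℕ) : List ℕ :=
  elts.map fun c => n / elts.countP fun v => Kind.klein.mem v && m (v, c * θ v * c⁻¹)

/-- The set with indicator function `m` has `n` elements, and orbit sizes described by `d₁`
on `D₄` and by `d` on `S₄`. -/
def Profile (m : D4 × D4 → Bool) (n : ℕ) (d₁ d : Multiset ℕ) : Prop :=
  pairs.countP m = n ∧ (innerSizes m n : Multiset ℕ) = expand d₁ ∧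
    ((innerSizes m n ++ (outerSizes conjLeft m n ++ outerSizes conjRight m n) : List ℕ) :
      Multiset ℕ) = expand d

instance (m n d₁ d) : Decidable (Profile m n d₁ d) := by
  unfold Profile expand; infer_instance

instance {N G : Type} [Group N] [Group G] [DecidableEq N] [DecidableEq G] (φ : G →* MulAut N) :
    DecidableEq (N ⋊[φ] G) := fun x y =>
  decidable_of_iff (x.left = y.left ∧ x.right = y.right) SemidirectProduct.ext_iff.symm

instance {N G : Type} [Group N] [Group G] [Fintype N] [Fintype G] (φ : G →* MulAut N) :
    Fintype (N ⋊[φ] G) := Fintype.ofEquiv _ SemidirectProduct.equivProd.symm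

/-- The products of the sublists of a list. -/
def subproducts {T : Type} [Group T] : List T → List T
  | [] => [1]
  | g :: L => subproducts L ++ (subproducts L).map (g * ·)

/-- `φ` is an isomorphism of `T` with the set with indicator function `m`; it suffices to test
multiplicativity on the members of a list the products of whose sublists exhaust `T`. -/
def Embeds {T : Type} [Group T] [Fintype T] [DecidableEq T] (m : D4 × D4 → Bool) (L : List T)
    (φ : T → D4 × D4) : Prop :=
  (∀ x, φ x = 1 ↔ x = 1) ∧ (∀ x, m (φ x) = true) ∧ (∀ x, ∀ g ∈ L, φ (x * g) = φ x * φ g) ∧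
    Fintype.card T = pairs.countP m ∧ ∀ x, x ∈ subproducts L

instance {T : Type} [Group T] [Fintype T] [DecidableEq T] (m : D4 × D4 → Bool) (L : List T)
    (φ : T → D4 × D4) : Decidable (Embeds m L φ) := by unfold Embeds; infer_instance

open Multiplicative in
/-- Generators of `(V₄ × V₄) ⋊ C₂`. -/
def gens32n27 : List G32n27 :=
  [⟨((ofAdd 1, 1), 1), 1⟩, ⟨((1, ofAdd 1), 1), 1⟩, ⟨(1, (ofAdd 1, 1)), 1⟩, ⟨(1, (1, ofAdd 1)), 1⟩,
    ⟨1, ofAdd 1⟩]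

open Multiplicative in
/-- Generators of `(C₄ × V₄) ⋊ C₂`. -/
def gens32n28 : List G32n28 :=
  [⟨(ofAdd 1, 1), 1⟩, ⟨(ofAdd 2, 1), 1⟩, ⟨(1, (ofAdd 1, 1)), 1⟩, ⟨(1, (1, ofAdd 1)), 1⟩,
    ⟨1, ofAdd 1⟩]

open Multiplicative in
/-- Generators of `(C₄ × C₄) ⋊ C₂`. -/
def gens32n34 : List G32n34 :=
  [⟨(ofAdd 1, 1), 1⟩, ⟨(ofAdd 2, 1), 1⟩, ⟨(1, ofAdd 1), 1⟩, ⟨(1, ofAdd 2), 1⟩, ⟨1, ofAdd 1⟩]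

open Multiplicative in
/-- Generators of `(C₄ × C₂) ⋊ C₂`. -/
def gens16n3 : List G16n3 :=
  [⟨(ofAdd 1, 1), 1⟩, ⟨(ofAdd 2, 1), 1⟩, ⟨(1, ofAdd 1), 1⟩, ⟨1, ofAdd 1⟩]

open Multiplicative in
/-- Generators of `C₄ ⋊ C₄`. -/
def gens16n4 : List G16n4 := [⟨ofAdd 1, 1⟩, ⟨ofAdd 2, 1⟩, ⟨1, ofAdd 1⟩, ⟨1, ofAdd 2⟩]

open Multiplicative in
/-- Generators of `D₄ × C₂`. -/
def gensD4C2 : List (D4 × C2) := [(sr 0, 1), (r 1, 1), (r 2, 1), (1, ofAdd 1)]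

open Multiplicative in
/-- Generators of `C₄ × C₂`. -/
def gensC4C2 : List (C4 × C2) := [(ofAdd 1, 1), (ofAdd 2, 1), (1, ofAdd 1)]

open Multiplicative in
/-- Generators of `V₄ × C₂`. -/
def gensV4C2 : List (V4 × C2) := [((ofAdd 1, 1), 1), ((1, ofAdd 1), 1), (1, ofAdd 1)]

/-- Powers with exponents in a cyclic group. -/
def cpow {n : ℕ} (x : D4 × D4) (e : Multiplicative (ZMod n)) : D4 × D4 := x ^ e.toAdd.val

/-- The map from `(V₄ × V₄) ⋊ C₂` given by generators. -/
def map32n27 (a c t : D4 × D4) (x : G32n27) : D4 × D4 :=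
  cpow a x.left.1.1 * cpow (t * a * t) x.left.1.2 * cpow c x.left.2.1 *
    cpow (t * c * t) x.left.2.2 * cpow t x.right

/-- The map from `(C₄ × V₄) ⋊ C₂` given by generators. -/
def map32n28 (x a t : D4 × D4) (w : G32n28) : D4 × D4 :=
  cpow x w.left.1 * cpow a w.left.2.1 * cpow (t * a * t) w.left.2.2 * cpow t w.right

/-- The map from `(C₄ × C₄) ⋊ C₂` given by generators. -/
def map32n34 (x y t : D4 × D4) (w : G32n34) : D4 × D4 :=
  cpow x w.left.1 * cpow y w.left.2 * cpow t w.right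

/-- The map from `(C₄ × C₂) ⋊ C₂` given by generators. -/
def map16n3 (x t : D4 × D4) (w : G16n3) : D4 × D4 :=
  cpow x w.left.1 * cpow (x⁻¹ * t * x * t) w.left.2 * cpow t w.right

/-- The map from `C₄ ⋊ C₄` given by generators. -/
def map16n4 (x y : D4 × D4) (w : G16n4) : D4 × D4 := cpow x w.left * cpow y w.right

/-- The map from `D₄ × C₂` given by generators. -/
def mapD4C2 (x s z : D4 × D4) (w : D4 × C2) : D4 × D4 :=
  (match w.1 with
    | r i => x ^ i.val
    | sr i => s * x ^ i.val) * cpow z w.2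

/-- The map from `C₄ × C₂` given by generators. -/
def mapC4C2 (x z : D4 × D4) (w : C4 × C2) : D4 × D4 := cpow x w.1 * cpow z w.2

/-- The map from `V₄ × C₂` given by generators. -/
def mapV4C2 (a b c : D4 × D4) (w : V4 × C2) : D4 × D4 :=
  cpow a w.1.1 * cpow b w.1.2 * cpow c w.2

/-- In this and the following predicates the membership and relation tests before `Embeds` only
prune the search for images of generators; `Embeds` alone certifies the isomorphism. The groups of
order 32 are fibre products of two copies of `D4` over `C2`, so few candidates suffice: here both
kernels are four-groups, the parities of `i` and `j` saying which. -/
def Is32n27 (m : D4 × D4 → Bool) : Prop :=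
  ∃ i ∈ [0, 1], ∃ j ∈ [0, 1], m (sr (i + 1), sr (j + 1)) = true ∧ m (sr i, 1) = true ∧
    Embeds m gens32n27 (map32n27 (sr i, 1) (1, sr j) (sr (i + 1), sr (j + 1)))

/-- One kernel is the rotation group and the other a four-group; the two alternatives say which side
is which. -/
def Is32n28 (m : D4 × D4 → Bool) : Prop :=
  ∃ i ∈ [0, 1],
    (m (sr (i + 1), sr 0) = true ∧ Embeds m gens32n28 (map32n28 (1, r 1) (sr i, 1) (sr (i + 1), sr 0))) ∨
    (m (sr 0, sr (i + 1)) = true ∧ Embeds m gens32n28 (map32n28 (r 1, 1) (1, sr i) (sr 0, sr (i + 1))))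

def Is32n34 (m : D4 × D4 → Bool) : Prop := Embeds m gens32n34 (map32n34 (r 1, 1) (1, r 1) (sr 0, sr 0))

def Is16n3 (m : D4 × D4 → Bool) : Prop :=
  ∃ x ∈ pairs, (m x = true ∧ x * x ≠ 1) ∧ ∃ t ∈ pairs,
    (m t = true ∧ t * t = 1 ∧ t * x ≠ x * t ∧ t * x * t ≠ x⁻¹) ∧ Embeds m gens16n3 (map16n3 x t)

def Is16n4 (m : D4 × D4 → Bool) : Prop :=
  ∃ x ∈ pairs, (m x = true ∧ x * x ≠ 1) ∧ ∃ y ∈ pairs,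
    (m y = true ∧ y * y ≠ 1 ∧ y * x = x⁻¹ * y ∧ y * y ≠ x * x) ∧ Embeds m gens16n4 (map16n4 x y)

def IsD4C2 (m : D4 × D4 → Bool) : Prop :=
  ∃ x ∈ pairs, (m x = true ∧ x * x ≠ 1) ∧ ∃ s ∈ pairs,
    (m s = true ∧ s * s = 1 ∧ s * x = x⁻¹ * s) ∧ ∃ z ∈ pairs,
    (m z = true ∧ z ≠ 1 ∧ z * z = 1 ∧ z * x = x * z ∧ z * s = s * z ∧ z ≠ x * x) ∧
      Embeds m gensD4C2 (mapD4C2 x s z)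

def IsC4C2 (m : D4 × D4 → Bool) : Prop :=
  ∃ x ∈ pairs, (m x = true ∧ x * x ≠ 1) ∧ ∃ z ∈ pairs,
    (m z = true ∧ z ≠ 1 ∧ z * z = 1 ∧ z ≠ x * x) ∧ Embeds m gensC4C2 (mapC4C2 x z)

def IsV4C2 (m : D4 × D4 → Bool) : Prop :=
  ∃ a ∈ pairs, (m a = true ∧ a ≠ 1) ∧ ∃ b ∈ pairs, (m b = true ∧ b ≠ 1 ∧ b ≠ a) ∧ ∃ c ∈ pairs,
    (m c = true ∧ c ≠ 1 ∧ c ≠ a ∧ c ≠ b ∧ c ≠ a * b) ∧ Embeds m gensV4C2 (mapV4C2 a b c)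

instance (m) : Decidable (Is32n27 m) := by unfold Is32n27; infer_instance
instance (m) : Decidable (Is32n28 m) := by unfold Is32n28; infer_instance
instance (m) : Decidable (Is32n34 m) := by unfold Is32n34; infer_instance
instance (m) : Decidable (Is16n3 m) := by unfold Is16n3; infer_instance
instance (m) : Decidable (Is16n4 m) := by unfold Is16n4; infer_instance
instance (m) : Decidable (IsD4C2 m) := by unfold IsD4C2; infer_instance
instance (m) : Decidable (IsC4C2 m) := by unfold IsC4C2; infer_instance
instance (m) : Decidable (IsV4C2 m) := by unfold IsV4C2; infer_instance

/-- A statement about indicator functions holds for all subgroups with projections of kinds `k`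
and `k'`. -/
def HoldsFor (k k' : Kind) (P : (D4 × D4 → Bool) → Prop) : Prop :=
  ∀ K ∈ subgroupLists, ∀ g₁ ∈ cosetReps K, ∀ g₂ ∈ cosetReps K, IsDatum k k' K g₁ g₂ →
    P (fiberMem k K g₁ g₂)

instance (k k' P) [DecidablePred P] : Decidable (HoldsFor k k' P) := by
  unfold HoldsFor; infer_instance

/-- In all these checks the disjuncts stand in the order of the table rows. No isomorphism is
certified when the order is that of the full product or of the first projection, because the order
alone then identifies the group. -/
lemma profiles_dih_cyc : HoldsFor .dih .cyc fun m =>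
    Profile m 32 {8} {16, 8} ∨
    (Profile m 16 {4, 4} {16, 4, 4} ∧ Is16n3 m) ∨
    (Profile m 16 {4, 4} {8, 8, 4, 4} ∧ Is16n3 m) ∨
    (Profile m 16 {8} {16, 8} ∧ Is16n4 m) := by decide +kernel

lemma profiles_dih_klein : HoldsFor .dih .klein fun m =>
    Profile m 32 {8} {8, 8, 8} ∨
    (Profile m 16 {8} {8, 8, 8} ∧ IsD4C2 m) ∨
    (Profile m 16 {8} {8, 8, 4, 4} ∧ IsD4C2 m) ∨
    (Profile m 16 {4, 4} {8, 8, 4, 4} ∧ IsD4C2 m) ∨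
    Profile m 8 {8} {8, 4, 4, 4, 4} ∨
    Profile m 8 {4, 4} {8, 4, 4, 4, 4} := by decide +kernel

lemma profiles_cyc_cyc : HoldsFor .cyc .cyc fun m =>
    Profile m 16 {4, 4} {16, 4, 4} ∨
    (Profile m 8 {2, 2, 2, 2} {8, 8, 2, 2, 2, 2} ∧ IsC4C2 m) ∨
    Profile m 4 {2, 2, 1, 1, 1, 1} {4, 4, 4, 4, 2, 2, 1, 1, 1, 1} := by decide +kernel

lemma profiles_cyc_klein : HoldsFor .cyc .klein fun m =>
    Profile m 16 {8} {8, 8, 8} ∨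
    (Profile m 8 {8} {8, 8, 4, 4} ∧ IsC4C2 m) ∨
    (Profile m 8 {4, 4} {8, 8, 4, 4} ∧ IsC4C2 m) := by decide +kernel

lemma profiles_klein_cyc : HoldsFor .klein .cyc fun m =>
    Profile m 16 {8} {8, 8, 8} ∨
    (Profile m 8 {8} {8, 8, 4, 4} ∧ IsC4C2 m) ∨
    (Profile m 8 {4, 4} {8, 8, 4, 4} ∧ IsC4C2 m) := by decide +kernel

lemma profiles_klein_klein : HoldsFor .klein .klein fun m =>
    Profile m 16 {4, 4} {4, 4, 4, 4, 4, 4} ∨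
    (Profile m 8 {4, 4} {4, 4, 4, 4, 2, 2, 2, 2} ∧ IsV4C2 m) ∨
    (Profile m 8 {4, 2, 2} {4, 4, 4, 4, 2, 2, 2, 2} ∧ IsV4C2 m) ∨
    (Profile m 8 {2, 2, 2, 2} {4, 4, 4, 4, 2, 2, 2, 2} ∧ IsV4C2 m) ∨
    Profile m 4 {4, 2, 2} {4, 4, 2, 2, 2, 2, 2, 2, 1, 1, 1, 1} ∨
    Profile m 4 {2, 2, 1, 1, 1, 1} {4, 4, 2, 2, 2, 2, 2, 2, 1, 1, 1, 1} := by decide +kernel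

lemma profiles_dih_dih : HoldsFor .dih .dih fun m =>
    Profile m 64 {8} {16, 8} ∨
    (Profile m 32 {8} {16, 8} ∧ Is32n27 m) ∨
    (Profile m 32 {4, 4} {16, 4, 4} ∧ Is32n27 m) ∨
    (Profile m 32 {4, 4} {8, 8, 4, 4} ∧ Is32n27 m) ∨
    (Profile m 32 {8} {16, 8} ∧ Is32n28 m) ∨
    (Profile m 32 {4, 4} {16, 4, 4} ∧ Is32n34 m) ∨
    (Profile m 16 {8} {16, 8} ∧ Is16n3 m) ∨
    (Profile m 16 {4, 4} {16, 4, 4} ∧ Is16n3 m) ∨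
    (Profile m 16 {4, 4} {8, 8, 4, 4} ∧ Is16n3 m) ∨
    (Profile m 16 {4, 4} {16, 4, 4} ∧ IsD4C2 m) ∨
    (Profile m 16 {2, 2, 2, 2} {8, 8, 2, 2, 2, 2} ∧ IsD4C2 m) ∨
    Profile m 8 {4, 2, 2} {8, 8, 4, 2, 2} ∨
    Profile m 8 {2, 2, 2, 1, 1} {8, 4, 4, 2, 2, 2, 1, 1} := by decide +kernel

end Finite

/-! ### Parametrization of subdirect products and their isomorphism types -/

section Subdirect

lemma mem_elts (d : D4) : d ∈ elts := by revert d; decide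

lemma mem_pairs (p : D4 × D4) : p ∈ pairs :=
  List.pair_mem_product.2 ⟨mem_elts p.1, mem_elts p.2⟩

lemma nodup_elts : elts.Nodup := by decide

lemma nodup_pairs : pairs.Nodup := nodup_elts.product nodup_elts

/-- The transitive subgroup of the given kind. -/
def Kind.subgroup (k : Kind) : Subgroup D4 where
  carrier := {d | k.mem d = true}
  one_mem' := by cases k <;> decide
  mul_mem' {a b} := by
    revert a b
    cases k <;> simp only [Set.mem_ofPred_eq] <;> decide
  inv_mem' {a} := by
    revert a
    cases k <;> simp only [Set.mem_ofPred_eq] <;> decide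

lemma Kind.mem_subgroup {k : Kind} {d : D4} : d ∈ k.subgroup ↔ k.mem d = true := Iff.rfl

lemma exists_subgroupList (F : Subgroup D4) : ∃ K ∈ subgroupLists, ∀ c, c ∈ K ↔ c ∈ F := by
  classical
  -- Exhaustion over all subsets; closure under inverses is automatic in a finite group.
  have key : ∀ s : Finset D4, 1 ∈ s → (∀ a ∈ s, ∀ b ∈ s, a * b ∈ s) →
      ∃ K ∈ subgroupLists, ∀ c, c ∈ K ↔ c ∈ s := by decide +kernel
  have := key (Finset.univ.filter (· ∈ F)) (by simp [F.one_mem]) (by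
    simp only [Finset.mem_filter, Finset.mem_univ, true_and]
    exact fun a ha b hb => F.mul_mem ha hb)
  simpa using this

/-- The hypotheses make `P` the indicator of a left coset of `K`. Its first element in the order of
`elts` is the one kept by `cosetReps`. -/
lemma exists_cosetRep {K : List D4} {P : D4 → Prop} {g : D4} (hg : P g)
    (hP : ∀ a b, P a → (P b ↔ a⁻¹ * b ∈ K)) : ∃ h ∈ cosetReps K, P h := by
  classical
  obtain ⟨h, hh⟩ : ∃ h, elts.find? (fun x => decide (P x)) = some h := by
    rw [← Option.isSome_iff_exists, List.find?_isSome]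
    exact ⟨g, mem_elts g, by simpa using hg⟩
  have hPh : P h := by simpa using List.find?_some hh
  refine ⟨h, ?_, hPh⟩
  have he : (fun x => decide (h⁻¹ * x ∈ K)) = fun x => decide (P x) := by
    funext x
    simp [hP h x hPh]
  simp [cosetReps, mem_elts, he, hh]

lemma Kind.word_mem {S : Subgroup (D4 × D4)} {k : Kind} {g₁ g₂ : D4}
    (h₁ : (k.gens.1, g₁) ∈ S) (h₂ : (k.gens.2, g₂) ∈ S) {d : D4} (hd : k.mem d = true) :
    (d, k.word g₁ g₂ d) ∈ S := by
  have hr : ∀ i : ZMod 4, (r 1 : D4) ^ i.val = r i := by decide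
  have hsr : ∀ i : ZMod 4, (sr 0 : D4) * r i = sr i := by decide
  cases k with
  | dih =>
    rcases d with i | i
    · have := S.pow_mem h₁ i.val
      rwa [Prod.pow_mk, Kind.gens, hr] at this
    · have := S.mul_mem h₂ (S.pow_mem h₁ i.val)
      rwa [Prod.pow_mk, Kind.gens, hr, Prod.mk_mul_mk, hsr] at this
  | cyc =>
    rcases d with i | i
    · have := S.pow_mem h₁ i.val
      rwa [Prod.pow_mk, Kind.gens, hr] at this
    · simp [Kind.mem] at hd
  | klein =>
    rcases d with i | i
    · by_cases hi : i = 0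
      · subst hi
        exact S.one_mem
      · have hi2 : i = 2 := by simpa [Kind.mem, hi] using hd
        subst hi2
        exact S.mul_mem h₁ h₂
    · by_cases hi : i = 1
      · subst hi
        exact h₁
      · have hi2 : i = 3 := by simpa [Kind.mem, hi] using hd
        subst hi2
        exact h₂

/-- The fibre of `S` above `d` is the left coset of `K = {c | (1, c) ∈ S}` through any lift of `d`,
and a word in lifts of the generators provides such a lift. Changing a lift within its coset is
harmless, so coset representatives suffice. Only the necessity of `IsDatum` is needed for the
enumeration to be complete. -/
lemma exists_fiberMem {S : Subgroup (D4 × D4)} {k k' : Kind}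
    (hk : S.map (MonoidHom.fst D4 D4) = k.subgroup)
    (hk' : S.map (MonoidHom.snd D4 D4) = k'.subgroup) :
    ∃ K ∈ subgroupLists, ∃ g₁ ∈ cosetReps K, ∃ g₂ ∈ cosetReps K, IsDatum k k' K g₁ g₂ ∧
      ∀ p, p ∈ S ↔ fiberMem k K g₁ g₂ p = true := by
  have hfst : ∀ d, k.mem d = true ↔ ∃ c, (d, c) ∈ S := fun d => by
    rw [← Kind.mem_subgroup, ← hk]; simp
  have hsnd : ∀ d, k'.mem d = true ↔ ∃ c, (c, d) ∈ S := fun d => by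
    rw [← Kind.mem_subgroup, ← hk']; simp
  obtain ⟨K, hK, hKS⟩ := exists_subgroupList (S.comap (MonoidHom.inr D4 D4))
  replace hKS : ∀ c, c ∈ K ↔ (1, c) ∈ S := by simpa using hKS
  have coset : ∀ d a b, (d, a) ∈ S → ((d, b) ∈ S ↔ a⁻¹ * b ∈ K) := fun d a b ha => by
    rw [hKS]
    constructor
    · intro hb
      simpa using S.mul_mem (S.inv_mem ha) hb
    · intro hb
      simpa using S.mul_mem ha hb
  obtain ⟨c₁, hc₁⟩ := (hfst k.gens.1).1 (by cases k <;> rfl)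
  obtain ⟨c₂, hc₂⟩ := (hfst k.gens.2).1 (by cases k <;> rfl)
  obtain ⟨g₁, hg₁, h₁⟩ := exists_cosetRep hc₁ (coset k.gens.1)
  obtain ⟨g₂, hg₂, h₂⟩ := exists_cosetRep hc₂ (coset k.gens.2)
  have hS : ∀ p, p ∈ S ↔ fiberMem k K g₁ g₂ p = true := by
    rintro ⟨d, c⟩
    simp only [fiberMem, Bool.and_eq_true, decide_eq_true_eq]
    constructor
    · intro h
      have hd := (hfst d).2 ⟨c, h⟩
      exact ⟨hd, (coset d _ _ (Kind.word_mem h₁ h₂ hd)).1 h⟩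
    · rintro ⟨hd, h⟩
      exact (coset d _ _ (Kind.word_mem h₁ h₂ hd)).2 h
  have closed : ∀ g ∈ S, IsClosedUnder k K g₁ g₂ g := fun g hg d _ hd c hc => by
    rw [← hS]
    refine S.mul_mem ?_ hg
    simpa using S.mul_mem (Kind.word_mem h₁ h₂ hd) ((hKS c).1 hc)
  refine ⟨K, hK, g₁, hg₁, g₂, hg₂, ⟨fun d _ => ?_, closed _ h₁, closed _ h₂⟩, hS⟩
  rw [hsnd]
  simp [mem_elts, ← hS]

/-- The finite check `HoldsFor` applies to every subgroup with the given projections. -/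
lemma HoldsFor.exists {S : Subgroup (D4 × D4)} {k k' : Kind} {P : (D4 × D4 → Bool) → Prop}
    (h : HoldsFor k k' P) (hk : S.map (MonoidHom.fst D4 D4) = k.subgroup)
    (hk' : S.map (MonoidHom.snd D4 D4) = k'.subgroup) :
    ∃ m : D4 × D4 → Bool, (∀ p, p ∈ S ↔ m p = true) ∧ P m := by
  obtain ⟨K, hK, g₁, hg₁, g₂, hg₂, hd, hS⟩ := exists_fiberMem hk hk'
  exact ⟨_, hS, h K hK g₁ hg₁ g₂ hg₂ hd⟩

variable {S : Subgroup (D4 × D4)} {m : D4 × D4 → Bool}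

lemma countP_pairs (hS : ∀ p, p ∈ S ↔ m p = true) : pairs.countP m = Nat.card S := by
  classical
  rw [List.countP_eq_length_filter, ← List.toFinset_card_of_nodup (nodup_pairs.filter _),
    Nat.card_eq_fintype_card, Fintype.card_subtype]
  congr 1
  ext p
  simp [mem_pairs, hS]

lemma mem_of_mem_subproducts {T : Type} [Group T] {N : Submonoid T} {L : List T}
    (hL : ∀ g ∈ L, g ∈ N) {x : T} (hx : x ∈ subproducts L) : x ∈ N := by
  induction L generalizing x with
  | nil => simp_all [subproducts]
  | cons g L ih =>
    have hL' : ∀ g ∈ L, g ∈ N := fun h hh => hL h (List.mem_cons_of_mem _ hh)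
    rw [subproducts, List.mem_append, List.mem_map] at hx
    rcases hx with hx | ⟨y, hy, rfl⟩
    · exact ih hL' hx
    · exact mul_mem (hL g List.mem_cons_self) (ih hL' hy)

lemma Embeds.nonempty_mulEquiv {T : Type} [Group T] [Fintype T] [DecidableEq T] {L : List T}
    {φ : T → D4 × D4} (h : Embeds m L φ) (hS : ∀ p, p ∈ S ↔ m p = true) :
    Nonempty (S ≃* T) := by
  obtain ⟨h1, h2, h3, h4, h5⟩ := h
  -- The right factors for which `φ` is multiplicative form a submonoid, so testing the list `L` is
  -- enough. Injectivity and equality of orders then give bijectivity.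
  let N : Submonoid T :=
    { carrier := {y | ∀ x, φ (x * y) = φ x * φ y}
      one_mem' := fun x => by rw [mul_one, (h1 1).2 rfl, mul_one]
      mul_mem' := fun {a b} ha hb x => by
        rw [← mul_assoc, hb, ha, hb a, mul_assoc] }
  have hN : ∀ x y, φ (x * y) = φ x * φ y := fun x y =>
    mem_of_mem_subproducts (N := N) (fun g hg x => h3 x g hg) (h5 y) x
  let ψ : T →* S := MonoidHom.mk' (fun x => ⟨φ x, (hS _).2 (h2 x)⟩) fun x y =>
    Subtype.ext (hN x y)
  have hψ : Function.Injective ψ := by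
    rw [injective_iff_map_eq_one]
    exact fun x hx => (h1 x).1 (congrArg Subtype.val hx)
  have hb : Function.Bijective ψ := by
    refine (Nat.bijective_iff_injective_and_card ψ).2 ⟨hψ, ?_⟩
    rw [Nat.card_eq_fintype_card, h4, countP_pairs hS]
  exact ⟨(MulEquiv.ofBijective ψ hb).symm⟩

lemma Is32n27.nonempty_mulEquiv (h : Is32n27 m) (hS : ∀ p, p ∈ S ↔ m p = true) :
    Nonempty (S ≃* G32n27) := by
  obtain ⟨_, _, _, _, _, _, h⟩ := h
  exact h.nonempty_mulEquiv hS

lemma Is32n28.nonempty_mulEquiv (h : Is32n28 m) (hS : ∀ p, p ∈ S ↔ m p = true) :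
    Nonempty (S ≃* G32n28) := by
  obtain ⟨_, _, ⟨_, h⟩ | ⟨_, h⟩⟩ := h <;> exact h.nonempty_mulEquiv hS

lemma Is32n34.nonempty_mulEquiv (h : Is32n34 m) (hS : ∀ p, p ∈ S ↔ m p = true) :
    Nonempty (S ≃* G32n34) :=
  Embeds.nonempty_mulEquiv h hS

lemma Is16n3.nonempty_mulEquiv (h : Is16n3 m) (hS : ∀ p, p ∈ S ↔ m p = true) :
    Nonempty (S ≃* G16n3) := by
  obtain ⟨_, _, _, _, _, _, h⟩ := h
  exact h.nonempty_mulEquiv hS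

lemma Is16n4.nonempty_mulEquiv (h : Is16n4 m) (hS : ∀ p, p ∈ S ↔ m p = true) :
    Nonempty (S ≃* G16n4) := by
  obtain ⟨_, _, _, _, _, _, h⟩ := h
  exact h.nonempty_mulEquiv hS

lemma IsD4C2.nonempty_mulEquiv (h : IsD4C2 m) (hS : ∀ p, p ∈ S ↔ m p = true) :
    Nonempty (S ≃* D4 × C2) := by
  obtain ⟨_, _, _, _, _, _, _, _, _, h⟩ := h
  exact h.nonempty_mulEquiv hS

lemma IsC4C2.nonempty_mulEquiv (h : IsC4C2 m) (hS : ∀ p, p ∈ S ↔ m p = true) :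
    Nonempty (S ≃* C4 × C2) := by
  obtain ⟨_, _, _, _, _, _, h⟩ := h
  exact h.nonempty_mulEquiv hS

lemma IsV4C2.nonempty_mulEquiv (h : IsV4C2 m) (hS : ∀ p, p ∈ S ↔ m p = true) :
    Nonempty (S ≃* V4 × C2) := by
  obtain ⟨_, _, _, _, _, _, _, _, _, h⟩ := h
  exact h.nonempty_mulEquiv hS

/-- The isomorphism type of the transitive subgroup. -/
def Kind.HasType (k : Kind) (T : Type) [Group T] : Prop := Nonempty (k.subgroup ≃* T)

lemma Kind.hasType_dih : Kind.dih.HasType D4 := by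
  have : Kind.dih.subgroup = ⊤ := by ext d; simp [Kind.mem_subgroup, Kind.mem]
  rw [Kind.HasType, this]
  exact ⟨Subgroup.topEquiv⟩

lemma Kind.card_subgroup (k : Kind) : Nat.card k.subgroup = elts.countP k.mem := by
  classical
  rw [List.countP_eq_length_filter, ← List.toFinset_card_of_nodup (nodup_elts.filter _),
    Nat.card_eq_fintype_card, Fintype.card_subtype]
  congr 1
  ext p
  simp [mem_elts, Kind.mem_subgroup]

lemma Kind.hasType_of_map {k : Kind} {T : Type} [Group T] [Fintype T] (φ : T → D4)
    (h1 : ∀ x, φ x = 1 → x = 1) (h2 : ∀ x, k.mem (φ x) = true)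
    (h3 : ∀ x y, φ (x * y) = φ x * φ y) (h4 : Fintype.card T = elts.countP k.mem) :
    k.HasType T := by
  let ψ : T →* k.subgroup := MonoidHom.mk' (fun x => ⟨φ x, h2 x⟩) fun x y => Subtype.ext (h3 x y)
  have hψ : Function.Injective ψ := by
    rw [injective_iff_map_eq_one]
    exact fun x hx => h1 x (congrArg Subtype.val hx)
  have hb : Function.Bijective ψ := by
    refine (Nat.bijective_iff_injective_and_card ψ).2 ⟨hψ, ?_⟩
    rw [Nat.card_eq_fintype_card, h4, Kind.card_subgroup]
  exact ⟨(MulEquiv.ofBijective ψ hb).symm⟩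

lemma Kind.hasType_cyc : Kind.cyc.HasType C4 :=
  Kind.hasType_of_map (fun x => r x.toAdd) (by decide) (by decide) (by decide) (by decide)

lemma Kind.hasType_klein : Kind.klein.HasType V4 :=
  Kind.hasType_of_map (fun x => (sr 1) ^ x.1.toAdd.val * (sr 3) ^ x.2.toAdd.val)
    (by decide) (by decide) (by decide) (by decide)

/-- A subdirect product with as many elements as the direct product is the direct product. -/
lemma nonempty_mulEquiv_prod {k k' : Kind} {T T' : Type} [Group T] [Group T']
    (hk : S.map (MonoidHom.fst D4 D4) = k.subgroup)
    (hk' : S.map (MonoidHom.snd D4 D4) = k'.subgroup) (hT : k.HasType T) (hT' : k'.HasType T')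
    (hc : Nat.card S = Nat.card k.subgroup * Nat.card k'.subgroup) :
    Nonempty (S ≃* T × T') := by
  have hle : S ≤ k.subgroup.prod k'.subgroup := by
    rw [← hk, ← hk']
    exact Subgroup.le_prod_iff.2 ⟨le_rfl, le_rfl⟩
  have hcard : Nat.card (k.subgroup.prod k'.subgroup) =
      Nat.card k.subgroup * Nat.card k'.subgroup := by
    rw [Nat.card_congr (Subgroup.prodEquiv _ _).toEquiv, Nat.card_prod]
  have heq : S = k.subgroup.prod k'.subgroup :=
    Subgroup.eq_of_le_of_card_ge hle (by rw [hcard, hc])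
  obtain ⟨e⟩ := hT
  obtain ⟨e'⟩ := hT'
  rw [heq]
  exact ⟨(Subgroup.prodEquiv _ _).trans (e.prodCongr e')⟩

/-- A subdirect product with as many elements as the first factor is isomorphic to it. -/
lemma nonempty_mulEquiv_fst {k : Kind} {T : Type} [Group T]
    (hk : S.map (MonoidHom.fst D4 D4) = k.subgroup) (hT : k.HasType T)
    (hc : Nat.card S = Nat.card k.subgroup) : Nonempty (S ≃* T) := by
  obtain ⟨e⟩ := hT
  let ψ : S →* k.subgroup := ((MonoidHom.fst D4 D4).comp S.subtype).codRestrict k.subgroup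
    fun x => hk ▸ ⟨x, x.2, rfl⟩
  have hψ : Function.Surjective ψ := by
    rintro ⟨d, hd⟩
    rw [← hk] at hd
    obtain ⟨p, hp, rfl⟩ := hd
    exact ⟨⟨p, hp⟩, rfl⟩
  have hb : Function.Bijective ψ := (Nat.bijective_iff_surjective_and_card ψ).2 ⟨hψ, hc⟩
  exact ⟨(MulEquiv.ofBijective ψ hb).trans e⟩

end Subdirect

/-! ### Orbits of a subdirect product on permutations -/

section Orbits

open Equiv

/-- The action of the dihedral group on four letters. -/
def letterMap : D4 → Fin 4 → Fin 4
  | r i => fun x : ZMod 4 => (x + i : ZMod 4)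
  | sr i => fun x : ZMod 4 => (-i - x : ZMod 4)

/-- The embedding of the dihedral group in the symmetric group. -/
def permHom : D4 →* Perm (Fin 4) :=
  MonoidHom.toHomPerm
    { toFun := letterMap
      map_one' := by
        have : ∀ x, letterMap 1 x = x := by decide
        exact funext this
      map_mul' := by
        have : ∀ a b x, letterMap (a * b) x = letterMap a (letterMap b x) := by decide +kernel
        exact fun a b => funext (this a b) }

lemma permHom_injective : Function.Injective permHom := by
  rw [injective_iff_map_eq_one]
  have : ∀ d : D4, (∀ x, permHom d x = x) → d = 1 := by decide +kernel
  exact fun d hd => this d fun x => by rw [hd]; rfl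

lemma permHom_r_one : permHom (r 1) = finRotate 4 := by decide +kernel

lemma permHom_sr_two : permHom (sr 2) = swap 0 2 := by decide +kernel

lemma range_permHom : permHom.range = dihedralSubgroup := by
  apply le_antisymm
  · have h1 : permHom (r 1) ∈ dihedralSubgroup := by
      rw [permHom_r_one]; exact Subgroup.subset_closure (by simp)
    have h2 : permHom (sr 2) ∈ dihedralSubgroup := by
      rw [permHom_sr_two]; exact Subgroup.subset_closure (by simp)
    have hr : ∀ i : ZMod 4, (r 1 : D4) ^ i.val = r i := by decide
    have hsr : ∀ i : ZMod 4, (sr 2 : D4) * (r 1) ^ (i - 2).val = sr i := by decide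
    rintro _ ⟨d, rfl⟩
    rcases d with i | i
    · rw [← hr, map_pow]
      exact pow_mem h1 _
    · rw [← hsr, map_mul, map_pow]
      exact mul_mem h2 (pow_mem h1 _)
  · rw [dihedralSubgroup, Subgroup.closure_le]
    rintro _ (rfl | rfl)
    · exact ⟨_, permHom_r_one⟩
    · exact ⟨_, permHom_sr_two⟩

/-- The orbit of a permutation `π` under `π ↦ τ π σ⁻¹` for `(σ, τ)` in `S`. -/
def twistOrbit (S : Subgroup (D4 × D4)) (π : Perm (Fin 4)) : Set (Perm (Fin 4)) :=
  Set.range fun p : S => permHom p.1.2 * π * (permHom p.1.1)⁻¹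

variable {S : Subgroup (D4 × D4)} {m : D4 × D4 → Bool}

lemma card_twistOrbit_mul (S : Subgroup (D4 × D4)) (π : Perm (Fin 4)) :
    Nat.card (twistOrbit S π) *
      Nat.card {p : S // permHom p.1.2 * π = π * permHom p.1.1} = Nat.card S := by
  let _ : MulAction S (Perm (Fin 4)) :=
    { smul := fun p π => permHom p.1.2 * π * (permHom p.1.1)⁻¹
      one_smul := fun π => by
        change permHom 1 * π * (permHom 1)⁻¹ = π
        simp
      mul_smul := fun p q π => by
        change permHom (p.1.2 * q.1.2) * π * (permHom (p.1.1 * q.1.1))⁻¹ =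
          permHom p.1.2 * (permHom q.1.2 * π * (permHom q.1.1)⁻¹) * (permHom p.1.1)⁻¹
        simp [mul_assoc] }
  have h := Nat.card_congr (MulAction.orbitProdStabilizerEquivGroup S π)
  rw [Nat.card_prod] at h
  rw [← h]
  congr 1
  refine Nat.card_congr (Equiv.subtypeEquivRight fun p => ?_)
  rw [MulAction.mem_stabilizer_iff]
  change _ ↔ permHom p.1.2 * π * (permHom p.1.1)⁻¹ = π
  rw [mul_inv_eq_iff_eq_mul]

/-- A stabilizing pair `(d, e)` has `e = π d π⁻¹`, so it is determined by `d`. Here `P` selects the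
`d` whose conjugate remains in the dihedral group and `θ` computes that conjugate; the count is then
orbit–stabilizer. -/
lemma card_twistOrbit (S : Subgroup (D4 × D4)) (π : Perm (Fin 4)) (P : D4 → Bool) (θ : D4 → D4)
    (hS : ∀ p, p ∈ S ↔ m p = true)
    (h : ∀ d e, permHom e * π = π * permHom d ↔ P d = true ∧ e = θ d) :
    Nat.card (twistOrbit S π) = Nat.card S / elts.countP fun d => P d && m (d, θ d) := by
  classical
  have hc : Nat.card {p : S // permHom p.1.2 * π = π * permHom p.1.1} =
      elts.countP fun d => P d && m (d, θ d) := by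
    rw [List.countP_eq_length_filter, ← List.toFinset_card_of_nodup (nodup_elts.filter _)]
    have : (elts.filter fun d => P d && m (d, θ d)).toFinset =
        Finset.univ.filter fun d => P d = true ∧ m (d, θ d) = true := by
      ext d
      simp [mem_elts]
    rw [this, ← Fintype.card_subtype, ← Nat.card_eq_fintype_card]
    exact Nat.card_congr
      { toFun := fun p => ⟨p.1.1.1, ((h _ _).1 p.2).1, by
          rw [← hS, ← ((h _ _).1 p.2).2]
          exact p.1.2⟩
        invFun := fun d => ⟨⟨(d.1, θ d.1), (hS _).2 d.2.2⟩, (h _ _).2 ⟨d.2.1, rfl⟩⟩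
        left_inv := fun p => Subtype.ext (Subtype.ext (Prod.ext rfl ((h _ _).1 p.2).2.symm))
        right_inv := fun d => rfl }
  have := card_twistOrbit_mul S π
  rw [hc] at this
  rw [← this, Nat.mul_div_cancel]
  rw [← hc]
  have : Nonempty {p : S // permHom p.1.2 * π = π * permHom p.1.1} := ⟨⟨1, by simp⟩⟩
  exact Nat.card_pos

lemma card_twistOrbit_inner (hS : ∀ p, p ∈ S ↔ m p = true) (c : D4) :
    Nat.card (twistOrbit S (permHom c)) =
      Nat.card S / elts.countP fun d => m (d, c * d * c⁻¹) := by
  rw [card_twistOrbit S (permHom c) (fun _ => true) (fun d => c * d * c⁻¹) hS]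
  · simp
  · intro d e
    rw [← map_mul, ← map_mul, permHom_injective.eq_iff, eq_mul_inv_iff_mul_eq]
    simp

lemma card_twistOrbit_outer {w : Perm (Fin 4)} {θ : D4 → D4}
    (hw : ∀ d e, permHom e * w = w * permHom d ↔ Kind.klein.mem d = true ∧ e = θ d)
    (hS : ∀ p, p ∈ S ↔ m p = true) (c : D4) :
    Nat.card (twistOrbit S (permHom c * w)) =
      Nat.card S / elts.countP fun v => Kind.klein.mem v && m (v, c * θ v * c⁻¹) := by
  refine card_twistOrbit S _ Kind.klein.mem (fun d => c * θ d * c⁻¹) hS fun d e => ?_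
  have h := hw d (c⁻¹ * e * c)
  rw [map_mul, map_mul, map_inv, mul_assoc, mul_assoc, inv_mul_eq_iff_eq_mul] at h
  rw [mul_assoc _ w, h, eq_mul_inv_iff_mul_eq, mul_assoc, inv_mul_eq_iff_eq_mul]

/-- Two distinct Sylow 2-subgroups of `S₄` meet exactly in the normal four-group, which is the one
of kind `klein`. -/
lemma permHom_mul_swap_left (d e : D4) : permHom e * swap 0 1 = swap 0 1 * permHom d ↔
    Kind.klein.mem d = true ∧ e = conjLeft d := by
  revert d e; decide +kernel

lemma permHom_mul_swap_right (d e : D4) : permHom e * swap 0 3 = swap 0 3 * permHom d ↔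
    Kind.klein.mem d = true ∧ e = conjRight d := by
  revert d e; decide +kernel

/-- The dihedral group has index three, and `1`, `(01)`, `(03)` represent its three right cosets. -/
lemma univ_perm : (Finset.univ : Finset (Perm (Fin 4))).val =
    (elts.map permHom ++ (elts.map (fun c => permHom c * swap 0 1) ++
      elts.map fun c => permHom c * swap 0 3) : List (Perm (Fin 4))) := by
  have h1 : (elts.map permHom ++ (elts.map (fun c => permHom c * swap 0 1) ++
      elts.map fun c => permHom c * swap 0 3)).Nodup := by decide +kernel
  have h2 : (⟨_, Multiset.coe_nodup.2 h1⟩ : Finset (Perm (Fin 4))) = Finset.univ := by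
    rw [← Finset.card_eq_iff_eq_univ]
    rfl
  rw [← h2]

lemma filter_dihedralSubgroup [DecidablePred (· ∈ dihedralSubgroup)] :
    (Finset.univ.filter (· ∈ dihedralSubgroup)).val = (elts.map permHom : Multiset _) := by
  have h1 : (elts.map permHom).Nodup := nodup_elts.map permHom_injective
  have h2 : (⟨_, Multiset.coe_nodup.2 h1⟩ : Finset (Perm (Fin 4))) =
      Finset.univ.filter (· ∈ dihedralSubgroup) := by
    ext π
    simp [← range_permHom, mem_elts]
  rw [← h2]

lemma Profile.inner {n : ℕ} {d₁ d : Multiset ℕ} (h : Profile m n d₁ d)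
    (hS : ∀ p, p ∈ S ↔ m p = true) [DecidablePred (· ∈ dihedralSubgroup)] :
    (Finset.univ.filter (· ∈ dihedralSubgroup)).val.map (fun π => Nat.card (twistOrbit S π)) =
      expand d₁ := by
  obtain ⟨h1, h2, -⟩ := h
  rw [filter_dihedralSubgroup, ← h2, ← h1, countP_pairs hS]
  simp [-Nat.card_coe_set_eq, innerSizes, card_twistOrbit_inner hS, Function.comp_def]

lemma Profile.outer {n : ℕ} {d₁ d : Multiset ℕ} (h : Profile m n d₁ d)
    (hS : ∀ p, p ∈ S ↔ m p = true) :
    (Finset.univ : Finset (Perm (Fin 4))).val.map (fun π => Nat.card (twistOrbit S π)) =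
      expand d := by
  obtain ⟨h1, -, h2⟩ := h
  rw [univ_perm, ← h2, ← h1, countP_pairs hS]
  simp [-Nat.card_coe_set_eq, innerSizes, outerSizes, card_twistOrbit_inner hS, Function.comp_def,
    card_twistOrbit_outer permHom_mul_swap_left hS, card_twistOrbit_outer permHom_mul_swap_right hS]

end Orbits

/-! ### Galois groups and degrees of splitting fields -/

section Galois

open IntermediateField

variable {M : Type*} [Field M]

/-- The Galois group of `f` is the image of any homomorphism from the automorphism group of the
algebraic closure whose kernel fixes exactly the roots of `f`. -/
lemma nonempty_gal_mulEquiv_range (f : M[X]) {G : Type*} [Group G]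
    (ψ : Gal(AlgebraicClosure M/M) →* G)
    (hψ : ∀ σ, ψ σ = 1 ↔ ∀ x ∈ f.rootSet (AlgebraicClosure M), σ x = x) :
    Nonempty (f.Gal ≃* ψ.range) := by
  have : Fact ((f.map (algebraMap M (AlgebraicClosure M))).Splits) :=
    ⟨IsAlgClosed.splits _⟩
  let R := Gal.restrict f (AlgebraicClosure M)
  -- Restriction to the splitting field is surjective, so equality of kernels identifies `f.Gal`
  -- with the image of `ψ`.
  have hR : R.ker = ψ.ker := by
    ext σ
    rw [MonoidHom.mem_ker, MonoidHom.mem_ker, hψ]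
    constructor
    · intro h x hx
      have := Gal.restrict_smul (p := f) (E := AlgebraicClosure M) σ ⟨x, hx⟩
      change ((R σ • (⟨x, hx⟩ : f.rootSet (AlgebraicClosure M)) : f.rootSet _) : _) = σ x at this
      rw [h, one_smul] at this
      exact this.symm
    · intro h
      refine (Gal.galActionHom_injective f (AlgebraicClosure M)) (Equiv.ext fun x => ?_)
      rw [map_one]
      apply Subtype.ext
      rw [Gal.galActionHom_restrict]
      exact h x x.2
  have e1 := QuotientGroup.quotientKerEquivOfSurjective R (Gal.restrict_surjective f _)
  have e2 := QuotientGroup.quotientKerEquivRange ψ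
  exact ⟨(e1.symm.trans (QuotientGroup.quotientMulEquivOfEq hR)).trans e2⟩

/-- For Galois extensions, the degrees of the compositum and of the intersection multiply to the
product of the degrees. -/
lemma finrank_sup_mul_finrank_inf {K E : Type*} [Field K] [Field E] [Algebra K E]
    (L L' : IntermediateField K E) [FiniteDimensional K L] [FiniteDimensional K L']
    [IsGalois K L] :
    Module.finrank K ↥(L ⊔ L') * Module.finrank K ↥(L ⊓ L') =
      Module.finrank K L * Module.finrank K L' := by
  let F := L ⊓ L'
  have h1 : F ≤ L := inf_le_left
  have h2 : F ≤ L' := inf_le_right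
  let L₁ := extendScalars h1
  let L₂ := extendScalars h2
  have h3 : F ≤ L ⊔ L' := h1.trans le_sup_left
  have : IsGalois K L₁ := ‹IsGalois K L›
  have : FiniteDimensional K L₁ := ‹FiniteDimensional K L›
  have : FiniteDimensional K L₂ := ‹FiniteDimensional K L'›
  have : IsGalois F L₁ := IsGalois.tower_top_of_isGalois K F L₁
  have : FiniteDimensional F L₁ := FiniteDimensional.right K F L₁
  have : FiniteDimensional F L₂ := FiniteDimensional.right K F L₂
  -- Over `F = L ⊓ L'` the two fields meet trivially and one is Galois, hence they are linearly
  -- disjoint and their degrees over `F` multiply.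
  have hbot : L₁ ⊓ L₂ = ⊥ := by
    rw [extendScalars_inf, ← extendScalars_self F]
  have hd := (LinearDisjoint.of_inf_eq_bot hbot).finrank_sup
  have hs : L₁ ⊔ L₂ = extendScalars h3 := extendScalars_sup ..
  rw [hs, ← relfinrank_eq_finrank_of_le, ← relfinrank_eq_finrank_of_le,
    ← relfinrank_eq_finrank_of_le] at hd
  rw [← finrank_bot_mul_relfinrank h1, ← finrank_bot_mul_relfinrank h2,
    ← finrank_bot_mul_relfinrank h3, hd]
  ring

lemma isGalois_splField {f : M[X]} (hf : f.Separable) : IsGalois M (splField f) := by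
  have : f.IsSplittingField M (splField f) :=
    adjoin_rootSet_isSplittingField (IsAlgClosed.splits _)
  exact IsGalois.of_separable_splitting_field hf

instance (f : M[X]) : FiniteDimensional M (splField f) := by
  have : f.IsSplittingField M (splField f) :=
    adjoin_rootSet_isSplittingField (IsAlgClosed.splits _)
  exact IsSplittingField.finiteDimensional _ f

lemma splField_mul {f g : M[X]} (hf : f ≠ 0) (hg : g ≠ 0) :
    splField (f * g) = splField f ⊔ splField g := by
  classical
  rw [splField, splField, splField, ← adjoin_union, rootSet, rootSet, rootSet,
    aroots_mul (mul_ne_zero hf hg), Multiset.toFinset_add, Finset.coe_union]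

lemma card_gal_eq_finrank {f : M[X]} (hf : IsGalois M (splField f)) :
    Nat.card f.Gal = Module.finrank M (splField f) := by
  have : f.IsSplittingField M (splField f) :=
    adjoin_rootSet_isSplittingField (IsAlgClosed.splits _)
  let e : splField f ≃ₐ[M] f.SplittingField := IsSplittingField.algEquiv _ f
  rw [← IsGalois.card_aut_eq_finrank]
  exact Nat.card_congr (AlgEquiv.autCongr e).symm.toEquiv

lemma finrank_inf_mul_card {f g : M[X]} (hf : f.Separable) (hg : g.Separable) :
    Nat.card (f * g).Gal * Module.finrank M ↥(splField f ⊓ splField g) =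
      Nat.card f.Gal * Nat.card g.Gal := by
  have h1 := isGalois_splField hf
  have h2 := isGalois_splField hg
  have h3 : IsGalois M (splField (f * g)) := by
    rw [splField_mul hf.ne_zero hg.ne_zero]
    infer_instance
  rw [card_gal_eq_finrank h1, card_gal_eq_finrank h2, card_gal_eq_finrank h3,
    splField_mul hf.ne_zero hg.ne_zero, finrank_sup_mul_finrank_inf]

end Galois

/-! ### Factor degrees as sizes of Galois orbits -/

section Conjugates

variable {M Ω : Type*} [Field M] [Field Ω] [Algebra M Ω] [IsAlgClosed Ω] [Algebra.IsAlgebraic M Ω]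

/-- By normality the conjugates of `x` are all the roots of its minimal polynomial, and separability
makes their number equal to the degree. -/
lemma natDegree_minpoly_eq_card_orbit {x : Ω} (hx : IsSeparable M x) :
    (minpoly M x).natDegree = Nat.card (Set.range fun σ : Gal(Ω/M) => σ x) := by
  classical
  have : Normal M Ω := normal_iff.2 fun y =>
    ⟨Algebra.IsIntegral.isIntegral y, IsAlgClosed.splits _⟩
  have hs : (Set.range fun σ : Gal(Ω/M) => σ x) = (minpoly M x).rootSet Ω := by
    ext y
    rw [mem_rootSet_of_ne (minpoly.ne_zero (Algebra.IsIntegral.isIntegral x))]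
    have h : minpoly M y = minpoly M x ↔ ∃ σ : Gal(Ω/M), σ x = y :=
      Normal.minpoly_eq_iff_mem_orbit Ω
    rw [Set.mem_range, ← h]
    constructor
    · intro hy
      rw [← hy, minpoly.aeval]
    · intro hy
      exact (minpoly.eq_of_irreducible_of_monic
        (minpoly.irreducible (Algebra.IsIntegral.isIntegral x)) hy
        (minpoly.monic (Algebra.IsIntegral.isIntegral x))).symm
  rw [hs, Nat.card_eq_fintype_card, card_rootSet_eq_natDegree hx (IsAlgClosed.splits _)]

lemma map_natDegree_minpoly_aroots {f : M[X]} (hf : Irreducible f) :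
    (f.aroots Ω).map (fun x => (minpoly M x).natDegree) =
      Multiset.replicate f.natDegree f.natDegree := by
  rw [Multiset.eq_replicate, Multiset.card_map]
  constructor
  · rw [aroots_def, ← (IsAlgClosed.splits (f.map (algebraMap M Ω))).natDegree_eq_card_roots,
      natDegree_map]
  · intro n hn
    obtain ⟨x, hx, rfl⟩ := Multiset.mem_map.1 hn
    rw [← minpoly.eq_of_irreducible hf (mem_aroots.1 hx).2,
      natDegree_mul_C (inv_ne_zero (leadingCoeff_ne_zero.2 hf.ne_zero))]

/-- The degrees of the irreducible factors of `R`, each repeated as often as its value, are the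
degrees of the roots. -/
lemma expand_factorDegrees {R : M[X]} (hR : R ≠ 0) :
    expand (factorDegrees R) = (R.aroots Ω).map fun x => (minpoly M x).natDegree := by
  have key : ∀ F : Multiset M[X], (∀ f ∈ F, Irreducible f) → F.prod ≠ 0 ∧
      expand (F.map natDegree) = (F.prod.aroots Ω).map fun x => (minpoly M x).natDegree := by
    intro F
    induction F using Multiset.induction_on with
    | empty => intro _; simp [expand]
    | cons f F ih =>
      intro h
      obtain ⟨h1, h2⟩ := ih fun g hg => h g (Multiset.mem_cons_of_mem hg)
      have hf := h f (Multiset.mem_cons_self f F)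
      have h0 : f * F.prod ≠ 0 := mul_ne_zero hf.ne_zero h1
      refine ⟨by rwa [Multiset.prod_cons], ?_⟩
      rw [Multiset.prod_cons, aroots_mul h0, Multiset.map_add, ← h2,
        map_natDegree_minpoly_aroots hf, Multiset.map_cons, expand, Multiset.cons_bind, expand]
  obtain ⟨h1, h2⟩ := key _ fun f => UniqueFactorizationMonoid.irreducible_of_factor f
  obtain ⟨u, hu⟩ := UniqueFactorizationMonoid.factors_prod hR
  obtain ⟨c, -, hc⟩ := isUnit_iff.1 u.isUnit
  rw [factorDegrees, h2]
  conv_rhs => rw [← hu, aroots_mul (by rwa [hu]), ← hc, aroots_C, add_zero]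

/-- A part `n` occurs `n` times as often after expansion, so its multiplicity can be recovered
unless `n = 0`. -/
lemma expand_injective {S T : Multiset ℕ} (hS : 0 ∉ S) (hT : 0 ∉ T) (h : expand S = expand T) :
    S = T := by
  have key : ∀ (S : Multiset ℕ) (n : ℕ), (expand S).count n = n * S.count n := by
    intro S n
    induction S using Multiset.induction_on with
    | empty => simp [expand]
    | cons a S ih =>
      rw [expand, Multiset.cons_bind, Multiset.count_add, ← expand, ih, Multiset.count_cons,
        Multiset.count_replicate]
      split_ifs <;> grind
  ext n
  rcases Nat.eq_zero_or_pos n with rfl | hn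
  · rw [Multiset.count_eq_zero_of_notMem hS, Multiset.count_eq_zero_of_notMem hT]
  · have := congrArg (Multiset.count n) h
    rw [key, key] at this
    exact Nat.eq_of_mul_eq_mul_left hn this

end Conjugates

/-! ### The resolvent as a product over permutations -/

section DecompositionType

open Equiv

variable {M : Type*} [Field M]

/-- `∑ xᵢ y_{π(i)}`, the form to which `P` is moved by the permutations `(σ, τ)` with
`π = τ σ⁻¹`. -/
noncomputable def twistedP (M : Type*) [Field M] (π : Perm (Fin 4)) : MvPolynomial (Fin 4 ⊕ Fin 4) M :=
  ∑ i, MvPolynomial.X (Sum.inl i) * MvPolynomial.X (Sum.inr (π i))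

lemma rename_invariantP (σ τ : Perm (Fin 4)) :
    MvPolynomial.rename (Perm.sumCongr σ τ) (invariantP M) = twistedP M (τ * σ⁻¹) := by
  simp only [invariantP, twistedP, map_sum, map_mul, MvPolynomial.rename_X, Perm.sumCongr_apply,
    Sum.map_inl, Sum.map_inr]
  refine Fintype.sum_equiv σ _ _ fun i => ?_
  simp

lemma aeval_twistedP {Ω : Type*} [Field Ω] [Algebra M Ω] (π : Perm (Fin 4)) (u v : Fin 4 → Ω) :
    MvPolynomial.aeval (Sum.elim u v) (twistedP M π) = ∑ i, u i * v (π i) := by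
  simp [twistedP]

/-- Setting `x_i = y_{π(i)} = 1` and the other variables to `0` detects the value at `i`. Hence the
resolvent has exactly one linear factor for each element of `Γ`. -/
lemma twistedP_injective : Function.Injective (twistedP M) := by
  intro π τ h
  ext1 i
  have := congrArg (MvPolynomial.aeval (R := M) (Sum.elim (Pi.single i (1 : M))
    (Pi.single (π i) (1 : M)))) h
  rw [aeval_twistedP, aeval_twistedP, Fintype.sum_eq_single i, Fintype.sum_eq_single i] at this
  · by_contra hne
    simp [Ne.symm hne] at this
  · intro j hj; simp [hj]
  · intro j hj; simp [hj]

lemma mem_permOrbit {K ι : Type*} [Field K] [Fintype ι] {G : Subgroup (Perm ι)}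
    {Θ Q : MvPolynomial ι K} :
    Q ∈ permOrbit G Θ ↔ ∃ π ∈ G, MvPolynomial.rename π Θ = Q := by
  -- In `permOrbit` the set of permutations is coerced to a set of functions through the monad
  -- structure of `Finset`, which accounts for the extra existential.
  simp only [permOrbit, Finset.mem_image, Finset.bind_def, Finset.pure_def, Finset.mem_sup,
    Finset.mem_filter, Finset.mem_univ, true_and, Finset.mem_singleton]
  constructor
  · rintro ⟨_, ⟨π, hπ, rfl⟩, h⟩
    exact ⟨π, hπ, h⟩
  · rintro ⟨π, hπ, h⟩
    exact ⟨π, ⟨π, hπ, rfl⟩, h⟩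

open Classical in
lemma permOrbit_invariantP (Γ : Subgroup (Perm (Fin 4))) :
    permOrbit (doubled Γ) (invariantP M) = (Finset.univ.filter (· ∈ Γ)).image (twistedP M) := by
  ext Q
  simp only [mem_permOrbit, doubled, Finset.mem_image, Finset.mem_filter, Finset.mem_univ,
    true_and]
  constructor
  · rintro ⟨_, ⟨⟨σ, τ⟩, ⟨hσ, hτ⟩, rfl⟩, rfl⟩
    exact ⟨τ * σ⁻¹, mul_mem hτ (inv_mem hσ), (rename_invariantP σ τ).symm⟩
  · rintro ⟨π, hπ, rfl⟩
    refine ⟨Perm.sumCongrHom _ _ (1, π), ⟨(1, π), ⟨one_mem _, hπ⟩, rfl⟩, ?_⟩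
    have := rename_invariantP (M := M) 1 π
    rwa [inv_one, mul_one] at this

open Classical in
lemma resolvent_invariantP {Ω : Type*} [Field Ω] [Algebra M Ω] (Γ : Subgroup (Perm (Fin 4)))
    (u v : Fin 4 → Ω) : resolvent (doubled Γ) (invariantP M) (Sum.elim u v) =
      ∏ π with π ∈ Γ, (X - C (∑ i, u i * v (π i))) := by
  rw [resolvent, permOrbit_invariantP, Finset.prod_image twistedP_injective.injOn]
  simp only [aeval_twistedP]

variable {Ω : Type*} [Field Ω] [Algebra M Ω]

/-- A squarefree polynomial has no repeated roots that are separable over the base field. -/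
lemma injOn_of_squarefree {ι : Type*} {s : Finset ι} {x : ι → Ω} {R : M[X]}
    (hR : R.map (algebraMap M Ω) = ∏ i ∈ s, (X - C (x i))) (hsq : Squarefree R)
    (hx : ∀ i, IsSeparable M (x i)) : Set.InjOn x s := by
  classical
  intro i hi j hj hij
  by_contra hne
  have hj' : j ∈ s.erase i := Finset.mem_erase.2 ⟨Ne.symm hne, hj⟩
  have hprod : R.map (algebraMap M Ω) =
      (X - C (x i)) * ((X - C (x i)) * ∏ k ∈ (s.erase i).erase j, (X - C (x k))) := by
    rw [hR, ← Finset.mul_prod_erase s _ hi, ← Finset.mul_prod_erase _ _ hj', hij]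
  have h0 : aeval (x i) R = 0 := by
    rw [aeval_def, eval₂_eq_eval_map, hprod]; simp
  obtain ⟨s₁, hs₁⟩ := minpoly.dvd M (x i) h0
  have hmin : (minpoly M (x i)).map (algebraMap M Ω) =
      (X - C (x i)) * ((minpoly M (x i)).map (algebraMap M Ω) /ₘ (X - C (x i))) := by
    rw [eq_comm, mul_divByMonic_eq_iff_isRoot, IsRoot, eval_map_algebraMap, minpoly.aeval]
  set q := (minpoly M (x i)).map (algebraMap M Ω) /ₘ (X - C (x i))
  -- The separable minimal polynomial absorbs only one of the two linear factors. Thus `x i` is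
  -- still a root of the cofactor `s₁`, and the square of the minimal polynomial divides `R`.
  have hq : eval (x i) q ≠ 0 := by
    have hsep : ((minpoly M (x i)).map (algebraMap M Ω)).Separable := Separable.map (hx i)
    rw [hmin] at hsep
    intro h
    obtain ⟨t, ht⟩ := dvd_iff_isRoot.2 h
    have := hsep.squarefree (X - C (x i)) ⟨t, by rw [ht]; ring⟩
    exact not_isUnit_X_sub_C _ this
  have hs : aeval (x i) s₁ = 0 := by
    have h1 : (X - C (x i)) * (q * s₁.map (algebraMap M Ω)) =
        (X - C (x i)) * ((X - C (x i)) * ∏ k ∈ (s.erase i).erase j, (X - C (x k))) := by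
      rw [← hprod, hs₁, Polynomial.map_mul, hmin, mul_assoc]
    have h2 := congrArg (eval (x i)) (mul_left_cancel₀ (X_sub_C_ne_zero _) h1)
    simp only [eval_mul, eval_sub, eval_X, eval_C, sub_self, zero_mul, mul_eq_zero, hq,
      false_or] at h2
    rwa [eval_map_algebraMap] at h2
  obtain ⟨s₂, hs₂⟩ := minpoly.dvd M (x i) hs
  have := hsq (minpoly M (x i)) ⟨s₂, by rw [hs₁, hs₂]; ring⟩
  exact minpoly.not_isUnit M (x i) this

variable [IsAlgClosed Ω] [Algebra.IsAlgebraic M Ω]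

/-- A separable element which is fixed by all automorphisms belongs to the base field. -/
lemma mem_range_of_fixed {x : Ω} (hx : IsSeparable M x) (h : ∀ σ : Gal(Ω/M), σ x = x) :
    x ∈ (algebraMap M Ω).range := by
  rw [← minpoly.natDegree_eq_one_iff, natDegree_minpoly_eq_card_orbit hx]
  have : (Set.range fun σ : Gal(Ω/M) => σ x) = {x} := by
    ext y; simp [h, eq_comm]
  rw [this]; simp

/-- A product of linear factors with separable roots permuted by the automorphisms is defined over
the base field. -/
lemma exists_map_eq_prod {ι : Type*} {s : Finset ι} {x : ι → Ω}
    (hx : ∀ i, IsSeparable M (x i))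
    (hσ : ∀ σ : Gal(Ω/M), ∃ e : ι ≃ ι, (∀ i, i ∈ s ↔ e i ∈ s) ∧ ∀ i, σ (x i) = x (e i)) :
    ∃ R : M[X], R.map (algebraMap M Ω) = ∏ i ∈ s, (X - C (x i)) := by
  -- Being fixed by all automorphisms gives membership in `M` only for separable elements, so the
  -- coefficients are first placed in the separable closure.
  have hsep : ∀ n, IsSeparable M ((∏ i ∈ s, (X - C (x i))).coeff n) := by
    have h : ∏ i ∈ s, (X - C (x i)) ∈ lifts (algebraMap (separableClosure M Ω) Ω) := by
      refine prod_mem fun i _ => ?_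
      refine ⟨X - C ⟨x i, mem_separableClosure_iff.2 (hx i)⟩, ?_⟩
      simp
    obtain ⟨Q, hQ⟩ := h
    intro n
    rw [← hQ, coe_mapRingHom, coeff_map]
    exact mem_separableClosure_iff.1 (Q.coeff n).2
  have hfix : ∀ σ : Gal(Ω/M), (∏ i ∈ s, (X - C (x i))).map (σ : Ω →+* Ω) =
      ∏ i ∈ s, (X - C (x i)) := by
    intro σ
    obtain ⟨e, he, hxe⟩ := hσ σ
    rw [Polynomial.map_prod]
    refine Finset.prod_equiv e he fun i _ => ?_
    simp [hxe]
  have hl : ∏ i ∈ s, (X - C (x i)) ∈ lifts (algebraMap M Ω) := by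
    rw [lifts_iff_coeff_lifts]
    refine fun n => mem_range_of_fixed (hsep n) fun σ => ?_
    conv_rhs => rw [← hfix σ, coeff_map]
    rfl
  obtain ⟨R, hR⟩ := hl
  exact ⟨R, by simpa using hR⟩

end DecompositionType

/-! ### The Galois action on the ordered roots -/

section RootOrdering

open Equiv

variable {M Ω : Type*} [Field M] [Field Ω] [Algebra M Ω] {a b : M} {α : Fin 4 → Ω}

lemma roots_prod_linear {ι : Type*} (s : Finset ι) (f : ι → Ω) :
    (∏ i ∈ s, (X - C (f i))).roots = s.val.map f := by
  have := roots_multiset_prod_X_sub_C (s.val.map f)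
  rwa [Multiset.map_map] at this

lemma IsRootOrdering.injective (hα : IsRootOrdering a b α) (hsep : (quartic a b).Separable) :
    Function.Injective α := by
  rw [← separable_prod_X_sub_C_iff, ← hα.1]
  exact hsep.map

lemma IsRootOrdering.mem_rootSet (hα : IsRootOrdering a b α) {x : Ω} :
    x ∈ (quartic a b).rootSet Ω ↔ ∃ i, α i = x := by
  classical
  rw [rootSet, aroots_def, hα.1, Finset.mem_coe, Multiset.mem_toFinset, roots_prod_linear,
    Multiset.mem_map]
  simp

lemma IsRootOrdering.aeval_eq_zero (hα : IsRootOrdering a b α) (i : Fin 4) :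
    aeval (α i) (quartic a b) = 0 :=
  aeval_eq_zero_of_mem_rootSet (hα.mem_rootSet.2 ⟨i, rfl⟩)

lemma IsRootOrdering.isSeparable (hα : IsRootOrdering a b α) (hsep : (quartic a b).Separable)
    (i : Fin 4) : IsSeparable M (α i) :=
  Separable.of_dvd hsep (minpoly.dvd M _ (hα.aeval_eq_zero i))

lemma IsRootOrdering.add_two (hα : IsRootOrdering a b α) (i : Fin 4) : α (i + 2) = -α i := by
  obtain ⟨-, h2, h3⟩ := hα
  fin_cases i
  · exact h2
  · exact h3
  · exact (neg_eq_iff_eq_neg.2 h2).symm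
  · exact (neg_eq_iff_eq_neg.2 h3).symm

/-- The Galois group permutes the ordered roots through the dihedral group. -/
lemma IsRootOrdering.exists_hom (hα : IsRootOrdering a b α) (hsep : (quartic a b).Separable) :
    ∃ ρ : Gal(Ω/M) →* D4, ∀ σ i, σ (α i) = α (permHom (ρ σ) i) := by
  have hinj := hα.injective hsep
  -- A symmetry of the square can send two adjacent vertices to any two adjacent vertices; opposite
  -- vertices differ by `2` modulo `4`.
  have key : ∀ i j : Fin 4, i ≠ j → j ≠ i + 2 →
      ∃ d, permHom d 0 = i ∧ permHom d 1 = j ∧ permHom d 2 = i + 2 ∧ permHom d 3 = j + 2 := by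
    decide +kernel
  have hex : ∀ σ : Gal(Ω/M), ∃ d, ∀ i, σ (α i) = α (permHom d i) := by
    intro σ
    have hroot : ∀ i, ∃ j, α j = σ (α i) := fun i => by
      rw [← hα.mem_rootSet]
      exact rootSet_mapsTo σ.toAlgHom (hα.mem_rootSet.2 ⟨i, rfl⟩)
    obtain ⟨i, hi⟩ := hroot 0
    obtain ⟨j, hj⟩ := hroot 1
    have hij : i ≠ j := by
      rintro rfl
      have := hinj (σ.injective (hi.symm.trans hj))
      exact absurd this (by decide)
    have hij2 : j ≠ i + 2 := by
      rintro rfl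
      rw [hα.add_two, hi, ← map_neg, ← hα.add_two] at hj
      exact absurd (hinj (σ.injective hj)) (by decide)
    obtain ⟨d, h0, h1, h2, h3⟩ := key i j hij hij2
    refine ⟨d, fun k => ?_⟩
    fin_cases k
    · change σ (α 0) = α (permHom d 0)
      rw [h0, hi]
    · change σ (α 1) = α (permHom d 1)
      rw [h1, hj]
    · change σ (α (0 + 2)) = α (permHom d 2)
      rw [h2, hα.add_two, hα.add_two, map_neg, hi]
    · change σ (α (1 + 2)) = α (permHom d 3)
      rw [h3, hα.add_two, hα.add_two, map_neg, hj]
  choose ρ hρ using hex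
  refine ⟨MonoidHom.mk' ρ fun σ τ => permHom_injective (Equiv.ext fun i => hinj ?_), hρ⟩
  rw [← hρ, map_mul, Perm.mul_apply, ← hρ, ← hρ]
  rfl

end RootOrdering

/-! ### Tschirnhausen transformations and decomposition types -/

section DecompositionType

open Equiv

variable {M Ω : Type*} [Field M] [Field Ω] [Algebra M Ω]

/-- Over an infinite field, some Tschirnhausen transformation of pairwise distinct elements avoids
finitely many given linear relations. -/
lemma exists_tschirnhausen [Infinite M] {α : Fin 4 → Ω} (hα : Function.Injective α)
    (W : Finset (Fin 4 → Ω)) (hW : ∀ w ∈ W, w ≠ 0) :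
    ∃ p : M[X], p.natDegree ≤ 3 ∧ ∀ w ∈ W, ∑ i, aeval (α i) p * w i ≠ 0 := by
  -- The transformation is sought as `1 + tX + t²X² + t³X³`. Relation `w` then becomes the
  -- polynomial `Q w` in `t`, nonzero by the Vandermonde determinant at the distinct `α i`; an
  -- infinite field has a `t` avoiding all the roots.
  let Q : (Fin 4 → Ω) → Polynomial Ω := fun w =>
    ∑ k : Fin 4, C (∑ i, w i * α i ^ (k : ℕ)) * X ^ (k : ℕ)
  have hQ : ∀ w ∈ W, Q w ≠ 0 := by
    intro w hw h
    refine hW w hw (Matrix.eq_zero_of_forall_pow_sum_mul_pow_eq_zero hα fun k => ?_)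
    have := congrArg (fun P => coeff P (k : ℕ)) h
    simpa only [Q, finsetSum_coeff, coeff_C_mul, coeff_X_pow, Fin.val_inj, mul_ite, mul_one,
      mul_zero, Finset.sum_ite_eq, Finset.mem_univ, if_true, coeff_zero] using this
  have hprod : ∏ w ∈ W, Q w ≠ 0 := Finset.prod_ne_zero_iff.2 hQ
  obtain ⟨t, ht⟩ : ∃ t : M, eval (algebraMap M Ω t) (∏ w ∈ W, Q w) ≠ 0 := by
    by_contra! h
    refine hprod (eq_zero_of_infinite_isRoot _ ?_)
    refine (Set.infinite_range_of_injective (algebraMap M Ω).injective).mono ?_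
    rintro _ ⟨t, rfl⟩
    exact h t
  refine ⟨∑ k : Fin 4, C (t ^ (k : ℕ)) * X ^ (k : ℕ), ?_, fun w hw h => ?_⟩
  · refine natDegree_sum_le_of_forall_le _ _ fun k _ => ?_
    exact (natDegree_C_mul_X_pow_le _ _).trans (by omega)
  · rw [eval_prod] at ht
    refine Finset.prod_ne_zero_iff.1 ht w hw ?_
    rw [← h]
    simp only [Q, eval_finsetSum, eval_mul, eval_C, eval_pow, eval_X, map_sum, map_mul, map_pow,
      aeval_C, aeval_X, Finset.sum_mul]
    rw [Finset.sum_comm]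
    exact Finset.sum_congr rfl fun i _ => Finset.sum_congr rfl fun k _ => by ring

variable {α β : Fin 4 → Ω} {ρ ρ' : Gal(Ω/M) →* D4}

/-- Reindexing the sum by `ρ σ` turns the Galois action on resolvent roots into the twisted action
on their indices. -/
lemma map_sum_aeval (hρ : ∀ σ i, σ (α i) = α (permHom (ρ σ) i))
    (hρ' : ∀ σ i, σ (β i) = β (permHom (ρ' σ) i)) (p q : M[X]) (σ : Gal(Ω/M))
    (π : Perm (Fin 4)) :
    σ (∑ i, aeval (α i) p * aeval (β (π i)) q) =
      ∑ i, aeval (α i) p *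
        aeval (β ((permHom (ρ' σ) * π * (permHom (ρ σ))⁻¹) i)) q := by
  have h : ∀ (x : Ω) (p : M[X]), σ (aeval x p) = aeval (σ x) p := fun x p =>
    (aeval_algHom_apply σ.toAlgHom x p).symm
  rw [map_sum]
  refine Fintype.sum_equiv (permHom (ρ σ)) _ _ fun i => ?_
  rw [map_mul, h, h, hρ, hρ']
  simp [Perm.mul_apply]

variable [IsAlgClosed Ω] [Algebra.IsAlgebraic M Ω]

open Classical in
-- On a squarefree resolvent, `π ↦ root` is injective and equivariant, so the degree of each root is
-- the size of the twisted orbit of its index. Any admissible pair therefore yields `D`; the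
-- converse needs one admissible pair, and `q = X` with a generic `p` works.
lemma hasDecompositionType_iff [Infinite M] (hα : Function.Injective α)
    (hβ : Function.Injective β) (hαs : ∀ i, IsSeparable M (α i)) (hβs : ∀ i, IsSeparable M (β i))
    (hρ : ∀ σ i, σ (α i) = α (permHom (ρ σ) i)) (hρ' : ∀ σ i, σ (β i) = β (permHom (ρ' σ) i))
    {Γ : Subgroup (Perm (Fin 4))} (hΓ : dihedralSubgroup ≤ Γ) {D : Multiset ℕ} (hD : 0 ∉ D)
    (horb : (Finset.univ.filter (· ∈ Γ)).val.map
      (fun π => Nat.card (twistOrbit (ρ.prod ρ').range π)) = expand D) (T : Multiset ℕ) :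
    HasDecompositionType (M := M) Γ α β T ↔ T = D := by
  have hperm : ∀ d, permHom d ∈ Γ := fun d => hΓ (range_permHom ▸ ⟨d, rfl⟩)
  have hsep : ∀ (p q : M[X]) (π : Perm (Fin 4)),
      IsSeparable M (∑ i, aeval (α i) p * aeval (β (π i)) q) := by
    intro p q π
    rw [← mem_separableClosure_iff]
    have h : ∀ (x : Ω) (p : M[X]), IsSeparable M x → aeval x p ∈ separableClosure M Ω := by
      intro x p hx
      have := aeval_algHom_apply (separableClosure M Ω).val ⟨x, mem_separableClosure_iff.2 hx⟩ p
      exact this ▸ SetLike.coe_mem _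
    exact sum_mem fun i _ => mul_mem (h _ _ (hαs i)) (h _ _ (hβs _))
  have types : ∀ (p q R : M[X]), R.map (algebraMap M Ω) = ∏ π with π ∈ Γ,
      (X - C (∑ i, aeval (α i) p * aeval (β (π i)) q)) → Squarefree R → factorDegrees R = D := by
    intro p q R hR hsq
    have hinj := injOn_of_squarefree hR hsq (hsep p q)
    refine expand_injective ?_ hD ?_
    · intro h
      obtain ⟨f, hf, h0⟩ := Multiset.mem_map.1 h
      exact (UniqueFactorizationMonoid.irreducible_of_factor f hf).natDegree_pos.ne' h0
    · rw [expand_factorDegrees (Ω := Ω) hsq.ne_zero, ← horb, aroots_def, hR, roots_prod_linear,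
        Multiset.map_map]
      refine Multiset.map_congr rfl fun π hπ => ?_
      have hπ : π ∈ Γ := by simpa using hπ
      rw [Function.comp_apply, natDegree_minpoly_eq_card_orbit (hsep p q π)]
      have himage : (Set.range fun σ : Gal(Ω/M) =>
          σ (∑ i, aeval (α i) p * aeval (β (π i)) q)) =
          (fun π : Perm (Fin 4) => ∑ i, aeval (α i) p * aeval (β (π i)) q) ''
            twistOrbit (ρ.prod ρ').range π := by
        ext y
        simp only [twistOrbit, Set.mem_range, Set.mem_image, map_sum_aeval hρ hρ']
        constructor
        · rintro ⟨σ, rfl⟩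
          exact ⟨_, ⟨⟨_, ⟨σ, rfl⟩⟩, rfl⟩, rfl⟩
        · rintro ⟨_, ⟨⟨_, ⟨σ, rfl⟩⟩, rfl⟩, rfl⟩
          exact ⟨σ, rfl⟩
      rw [himage]
      refine Nat.card_image_of_injOn (hinj.mono ?_)
      rintro _ ⟨s, rfl⟩
      simpa using mul_mem (mul_mem (hperm _) hπ) (inv_mem (hperm _))
  constructor
  · rintro ⟨p, q, -, -, -, -, R, hR, hsq, rfl⟩
    rw [resolvent_invariantP] at hR
    exact types p q R hR hsq
  · rintro rfl
    -- The first family of relations keeps the `p(α_i)` distinct. The second separates the resolvent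
    -- roots for all of `S₄`, whatever `Γ` is.
    obtain ⟨p, hp, hpW⟩ := exists_tschirnhausen (M := M) hα
      ((Finset.univ.offDiag.image fun i : Fin 4 × Fin 4 =>
          (Pi.single i.1 1 - Pi.single i.2 1 : Fin 4 → Ω)) ∪
        Finset.univ.offDiag.image fun π : Perm (Fin 4) × Perm (Fin 4) => β ∘ π.1 - β ∘ π.2) (by
        intro w hw
        simp only [Finset.mem_union, Finset.mem_image, Finset.mem_offDiag, Finset.mem_univ,
          true_and] at hw
        rcases hw with ⟨⟨i, j⟩, hij, rfl⟩ | ⟨⟨π, τ⟩, hij, rfl⟩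
        · intro h
          have := congrFun h i
          simp [show i ≠ j from hij] at this
        · intro h
          refine hij (Equiv.ext fun i => hβ ?_)
          exact sub_eq_zero.1 (congrFun h i))
    have h1 : Function.Injective fun i => aeval (α i) p := by
      intro i j hij
      by_contra hne
      refine hpW _ (Finset.mem_union_left _ (Finset.mem_image.2 ⟨(i, j), by simpa, rfl⟩)) ?_
      simpa [mul_sub, Pi.single_apply, sub_eq_zero] using hij
    have h2 : Function.Injective fun π : Perm (Fin 4) =>
        ∑ i, aeval (α i) p * aeval (β (π i)) (X : M[X]) := by
      intro π τ hij
      by_contra hne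
      refine hpW _ (Finset.mem_union_right _ (Finset.mem_image.2 ⟨(π, τ), by simpa, rfl⟩)) ?_
      simpa [mul_sub, sub_eq_zero] using hij
    obtain ⟨R, hR⟩ := exists_map_eq_prod (s := Finset.univ.filter (· ∈ Γ)) (hsep p X) fun σ =>
      ⟨(Equiv.mulLeft (permHom (ρ' σ))).trans (Equiv.mulRight (permHom (ρ σ))⁻¹), fun π => by
        simp [Subgroup.mul_mem_cancel_left, Subgroup.mul_mem_cancel_right, hperm],
        fun π => map_sum_aeval hρ hρ' p X σ π⟩
    have hsq : Squarefree R := by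
      refine Separable.squarefree ((separable_map (algebraMap M Ω)).1 ?_)
      rw [hR]
      exact separable_prod_X_sub_C_iff'.2 fun π _ τ _ h => h2 h
    refine ⟨p, X, hp, by simp, h1, by simpa using hβ, R, ?_, hsq, types p X R hR hsq⟩
    rw [resolvent_invariantP, hR]

end DecompositionType

/-! ### Assembling the rows of the tables -/

section Tables

open Equiv

lemma exists_kind {F : Subgroup D4} (hF : ∀ i, ∃ d ∈ F, permHom d 0 = i) :
    ∃ k : Kind, F = k.subgroup := by
  have key : ∀ K ∈ subgroupLists, (∀ i, ∃ d ∈ K, permHom d 0 = i) →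
      (∀ d, d ∈ K ↔ Kind.dih.mem d = true) ∨ (∀ d, d ∈ K ↔ Kind.cyc.mem d = true) ∨
      (∀ d, d ∈ K ↔ Kind.klein.mem d = true) := by decide +kernel
  obtain ⟨K, hK, hKF⟩ := exists_subgroupList F
  simp only [← hKF] at hF
  rcases key K hK hF with h | h | h
  · exact ⟨.dih, by ext d; rw [← hKF, h, Kind.mem_subgroup]⟩
  · exact ⟨.cyc, by ext d; rw [← hKF, h, Kind.mem_subgroup]⟩
  · exact ⟨.klein, by ext d; rw [← hKF, h, Kind.mem_subgroup]⟩

/-- The numerical form of a condition on the intersection of two Galois extensions of degrees `c`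
and `c'` whose compositum has degree `n`. -/
def Meet.Fits (n c c' : ℕ) : Meet → Prop
  | .trivial => n = c * c'
  | .degree e => n * e = c * c'
  | .equal => n = c ∧ n = c'
  | .contains => n = c ∧ c' < c

instance (n c c' : ℕ) (e : Meet) : Decidable (e.Fits n c c') := by
  cases e <;> unfold Meet.Fits <;> infer_instance

lemma Meet.Fits.holds {K E : Type*} [Field K] [Field E] [Algebra K E]
    {L L' : IntermediateField K E} [FiniteDimensional K L] [FiniteDimensional K L']
    {n : ℕ} (hn : 0 < n) {e : Meet}
    (h : e.Fits n (Module.finrank K L) (Module.finrank K L'))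
    (hL : n * Module.finrank K ↥(L ⊓ L') = Module.finrank K L * Module.finrank K L') :
    e.Holds L L' := by
  have hc : 0 < Module.finrank K L := Module.finrank_pos
  -- If the compositum is no larger than `L`, the degree formula gives `L ⊓ L'` the degree of `L'`.
  have right : n = Module.finrank K L → L ⊓ L' = L' := fun h1 => by
    rw [← h1] at hL
    exact IntermediateField.eq_of_le_of_finrank_eq inf_le_right (Nat.eq_of_mul_eq_mul_left hn hL)
  cases e with
  | trivial =>
    refine IntermediateField.finrank_eq_one_iff.1 (Nat.eq_of_mul_eq_mul_left hn ?_)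
    rw [hL, mul_one, h]
  | degree e => exact Nat.eq_of_mul_eq_mul_left hn (hL.trans (Eq.symm h))
  | equal =>
    obtain ⟨h1, h2⟩ := h
    have h3 := right h1
    have h4 : L' ≤ L := inf_eq_right.1 h3
    exact (IntermediateField.eq_of_le_of_finrank_eq h4 (h2.symm.trans h1)).symm
  | contains =>
    obtain ⟨h1, h2⟩ := h
    refine lt_of_le_of_ne (inf_eq_right.1 (right h1)) ?_
    rintro rfl
    exact lt_irrefl _ h2

variable {M : Type*} [Field M] {f f' : M[X]} {α β : Fin 4 → AlgebraicClosure M} {k k' : Kind}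
  {S : Subgroup (D4 × D4)}

/-- The Galois groups of `f`, `f'` and `f f'` are the projections of `S`, of kinds `k` and `k'`,
and `S` itself; the intersection of the splitting fields has the corresponding degree and the
decomposition types are given by orbits of `S`. -/
structure IsGaloisDatum (f f' : M[X]) (α β : Fin 4 → AlgebraicClosure M) (k k' : Kind)
    (S : Subgroup (D4 × D4)) : Prop where
  map_fst : S.map (MonoidHom.fst D4 D4) = k.subgroup
  map_snd : S.map (MonoidHom.snd D4 D4) = k'.subgroup
  gal_fst : Nonempty (f.Gal ≃* k.subgroup)
  gal_snd : Nonempty (f'.Gal ≃* k'.subgroup)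
  gal_mul : Nonempty ((f * f').Gal ≃* S)
  separable_fst : f.Separable
  separable_snd : f'.Separable
  inner_iff : ∀ {m n d₁ d}, (∀ p, p ∈ S ↔ m p = true) → Profile m n d₁ d → 0 ∉ d₁ →
    ∀ T, HasDecompositionType (M := M) dihedralSubgroup α β T ↔ T = d₁
  outer_iff : ∀ {m n d₁ d}, (∀ p, p ∈ S ↔ m p = true) → Profile m n d₁ d → 0 ∉ d →
    ∀ T, HasDecompositionType (M := M) ⊤ α β T ↔ T = d

/-- The order of `S` settles the intersection column and its profile settles both decomposition
types. The remaining numerical conditions are discharged by the default arguments. -/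
lemma IsGaloisDatum.row (h : IsGaloisDatum f f' α β k k' S) {T T' H : Type} [Group T] [Group T']
    [Group H] (hT : k.HasType T) (hT' : k'.HasType T') {m : D4 × D4 → Bool}
    (hS : ∀ p, p ∈ S ↔ m p = true) {n : ℕ} {d₁ d : Multiset ℕ} (hP : Profile m n d₁ d)
    (hH : Nonempty (S ≃* H)) {e : Meet}
    (he : e.Fits n (elts.countP k.mem) (elts.countP k'.mem) := by decide)
    (h₁ : 0 ∉ d₁ := by decide) (h₂ : 0 ∉ d := by decide) : Row f f' α β T T' H e d₁ d := by
  obtain ⟨g⟩ := h.gal_fst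
  obtain ⟨g'⟩ := h.gal_snd
  obtain ⟨gm⟩ := h.gal_mul
  obtain ⟨t⟩ := hT
  obtain ⟨t'⟩ := hT'
  obtain ⟨s⟩ := hH
  have hn : Nat.card S = n := by rw [← countP_pairs hS, hP.1]
  have hL := card_gal_eq_finrank (isGalois_splField h.separable_fst)
  have hL' := card_gal_eq_finrank (isGalois_splField h.separable_snd)
  have hinf := finrank_inf_mul_card h.separable_fst h.separable_snd
  rw [Nat.card_congr gm.toEquiv, hn, hL, hL'] at hinf
  rw [Nat.card_congr g.toEquiv, Kind.card_subgroup] at hL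
  rw [Nat.card_congr g'.toEquiv, Kind.card_subgroup] at hL'
  rw [hL, hL'] at he
  exact ⟨⟨g.trans t⟩, ⟨g'.trans t'⟩, ⟨gm.trans s⟩, he.holds (hn ▸ Nat.card_pos) hinf,
    h.inner_iff hS hP h₁, h.outer_iff hS hP h₂⟩

/-- The row for linearly disjoint splitting fields. -/
lemma IsGaloisDatum.row_prod (h : IsGaloisDatum f f' α β k k' S) {T T' : Type} [Group T]
    [Group T'] (hT : k.HasType T) (hT' : k'.HasType T') {m : D4 × D4 → Bool}
    (hS : ∀ p, p ∈ S ↔ m p = true) {n : ℕ} {d₁ d : Multiset ℕ} (hP : Profile m n d₁ d)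
    (he : n = elts.countP k.mem * elts.countP k'.mem := by decide)
    (h₁ : 0 ∉ d₁ := by decide) (h₂ : 0 ∉ d := by decide) :
    Row f f' α β T T' (T × T') .trivial d₁ d :=
  h.row hT hT' hS hP (nonempty_mulEquiv_prod h.map_fst h.map_snd hT hT' (by
    rw [← countP_pairs hS, hP.1, Kind.card_subgroup, Kind.card_subgroup, he])) he h₁ h₂

/-- The row for splitting fields one of which contains the other. -/
lemma IsGaloisDatum.row_fst (h : IsGaloisDatum f f' α β k k' S) {T T' : Type} [Group T]
    [Group T'] (hT : k.HasType T) (hT' : k'.HasType T') {m : D4 × D4 → Bool}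
    (hS : ∀ p, p ∈ S ↔ m p = true) {n : ℕ} {d₁ d : Multiset ℕ} (hP : Profile m n d₁ d) {e : Meet}
    (he : e.Fits n (elts.countP k.mem) (elts.countP k'.mem) := by decide)
    (hn : n = elts.countP k.mem := by decide)
    (h₁ : 0 ∉ d₁ := by decide) (h₂ : 0 ∉ d := by decide) :
    Row f f' α β T T' T e d₁ d :=
  h.row hT hT' hS hP (nonempty_mulEquiv_fst h.map_fst hT (by
    rw [← countP_pairs hS, hP.1, Kind.card_subgroup, hn])) he h₁ h₂

lemma IsGaloisDatum.tableD4 (h : IsGaloisDatum f f' α β .dih k' S) : TableD4 f f' α β := by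
  have hD := Kind.hasType_dih
  have hC := Kind.hasType_cyc
  have hV := Kind.hasType_klein
  cases k' with
  | dih =>
    obtain ⟨m, hS, hP⟩ := profiles_dih_dih.exists h.map_fst h.map_snd
    exact hP.imp (fun p => h.row_prod hD hD hS p) <|
      Or.imp (fun p => h.row hD hD hS p.1 (p.2.nonempty_mulEquiv hS)) <|
      Or.imp (fun p => h.row hD hD hS p.1 (p.2.nonempty_mulEquiv hS)) <|
      Or.imp (fun p => h.row hD hD hS p.1 (p.2.nonempty_mulEquiv hS)) <|
      Or.imp (fun p => h.row hD hD hS p.1 (p.2.nonempty_mulEquiv hS)) <|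
      Or.imp (fun p => h.row hD hD hS p.1 (p.2.nonempty_mulEquiv hS)) <|
      Or.imp (fun p => h.row hD hD hS p.1 (p.2.nonempty_mulEquiv hS)) <|
      Or.imp (fun p => h.row hD hD hS p.1 (p.2.nonempty_mulEquiv hS)) <|
      Or.imp (fun p => h.row hD hD hS p.1 (p.2.nonempty_mulEquiv hS)) <|
      Or.imp (fun p => h.row hD hD hS p.1 (p.2.nonempty_mulEquiv hS)) <|
      Or.imp (fun p => h.row hD hD hS p.1 (p.2.nonempty_mulEquiv hS)) <|
      Or.imp (fun p => h.row_fst hD hD hS p) fun p => Or.inl (h.row_fst hD hD hS p)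
  | cyc =>
    obtain ⟨m, hS, hP⟩ := profiles_dih_cyc.exists h.map_fst h.map_snd
    -- The 13 rows with `G' ≅ D4` come first.
    iterate 13 apply Or.inr
    exact hP.imp (fun p => h.row_prod hD hC hS p) <|
      Or.imp (fun p => h.row hD hC hS p.1 (p.2.nonempty_mulEquiv hS)) <|
      Or.imp (fun p => h.row hD hC hS p.1 (p.2.nonempty_mulEquiv hS)) fun p =>
        Or.inl (h.row hD hC hS p.1 (p.2.nonempty_mulEquiv hS))
  | klein =>
    obtain ⟨m, hS, hP⟩ := profiles_dih_klein.exists h.map_fst h.map_snd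
    -- The 13 rows for `D4` and the 4 rows for `C4` come first.
    iterate 17 apply Or.inr
    exact hP.imp (fun p => h.row_prod hD hV hS p) <|
      Or.imp (fun p => h.row hD hV hS p.1 (p.2.nonempty_mulEquiv hS)) <|
      Or.imp (fun p => h.row hD hV hS p.1 (p.2.nonempty_mulEquiv hS)) <|
      Or.imp (fun p => h.row hD hV hS p.1 (p.2.nonempty_mulEquiv hS)) <|
      Or.imp (fun p => h.row_fst hD hV hS p) fun p => h.row_fst hD hV hS p

lemma IsC4C2.nonempty_mulEquiv_swap {m : D4 × D4 → Bool} (h : IsC4C2 m)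
    (hS : ∀ p, p ∈ S ↔ m p = true) : Nonempty (S ≃* C2 × C4) :=
  (h.nonempty_mulEquiv hS).map fun e => e.trans MulEquiv.prodComm

lemma IsGaloisDatum.tableC4V4 (h : IsGaloisDatum f f' α β k k' S) (hk : k ≠ .dih)
    (hk' : k' ≠ .dih) : TableC4V4 f f' α β := by
  have hC := Kind.hasType_cyc
  have hV := Kind.hasType_klein
  cases k with
  | dih => exact absurd rfl hk
  | cyc =>
    cases k' with
    | dih => exact absurd rfl hk'
    | cyc =>
      obtain ⟨m, hS, hP⟩ := profiles_cyc_cyc.exists h.map_fst h.map_snd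
      exact hP.imp (fun p => h.row_prod hC hC hS p) <|
        Or.imp (fun p => h.row hC hC hS p.1 (p.2.nonempty_mulEquiv hS)) fun p =>
          Or.inl (h.row_fst hC hC hS p)
    | klein =>
      obtain ⟨m, hS, hP⟩ := profiles_cyc_klein.exists h.map_fst h.map_snd
      iterate 3 apply Or.inr
      exact hP.imp (fun p => h.row_prod hC hV hS p) <|
        Or.imp (fun p => h.row hC hV hS p.1 (p.2.nonempty_mulEquiv hS)) fun p =>
          Or.inl (h.row hC hV hS p.1 (p.2.nonempty_mulEquiv hS))
  | klein =>
    cases k' with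
    | dih => exact absurd rfl hk'
    | cyc =>
      obtain ⟨m, hS, hP⟩ := profiles_klein_cyc.exists h.map_fst h.map_snd
      iterate 6 apply Or.inr
      exact hP.imp (fun p => h.row_prod hV hC hS p) <|
        Or.imp (fun p => h.row hV hC hS p.1 (p.2.nonempty_mulEquiv_swap hS)) fun p =>
          Or.inl (h.row hV hC hS p.1 (p.2.nonempty_mulEquiv_swap hS))
    | klein =>
      obtain ⟨m, hS, hP⟩ := profiles_klein_klein.exists h.map_fst h.map_snd
      iterate 9 apply Or.inr
      exact hP.imp (fun p => h.row_prod hV hV hS p) <|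
        Or.imp (fun p => h.row hV hV hS p.1 (p.2.nonempty_mulEquiv hS)) <|
        Or.imp (fun p => h.row hV hV hS p.1 (p.2.nonempty_mulEquiv hS)) <|
        Or.imp (fun p => h.row hV hV hS p.1 (p.2.nonempty_mulEquiv hS)) <|
        Or.imp (fun p => h.row_fst hV hV hS p) fun p => h.row_fst hV hV hS p

/-- For an irreducible quartic, the image of the Galois group in the dihedral group is
transitive. -/
lemma exists_range_eq_subgroup {a b : M} (hirr : Irreducible (quartic a b))
    (hα : IsRootOrdering a b α) {ρ : Gal(AlgebraicClosure M/M) →* D4}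
    (hinj : Function.Injective α) (hρ : ∀ σ i, σ (α i) = α (permHom (ρ σ) i)) :
    ∃ k : Kind, ρ.range = k.subgroup := by
  refine exists_kind fun i => ?_
  have h : minpoly M (α i) = minpoly M (α 0) := by
    rw [← minpoly.eq_of_irreducible hirr (hα.aeval_eq_zero i),
      ← minpoly.eq_of_irreducible hirr (hα.aeval_eq_zero 0)]
  obtain ⟨σ, hσ⟩ := (Normal.minpoly_eq_iff_mem_orbit (AlgebraicClosure M)).1 h
  exact ⟨ρ σ, ⟨σ, rfl⟩, hinj ((hρ σ 0).symm.trans hσ)⟩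

/-- This is the kernel condition that identifies the image of `ρ` with the Galois group, since `D4`
acts faithfully on the letters. -/
lemma hom_eq_one_iff {a b : M} (hα : IsRootOrdering a b α)
    {ρ : Gal(AlgebraicClosure M/M) →* D4} (hinj : Function.Injective α)
    (hρ : ∀ σ i, σ (α i) = α (permHom (ρ σ) i)) (σ : Gal(AlgebraicClosure M/M)) :
    ρ σ = 1 ↔ ∀ x ∈ (quartic a b).rootSet (AlgebraicClosure M), σ x = x := by
  rw [← permHom_injective.eq_iff, map_one, Equiv.ext_iff]
  constructor
  · intro h x hx
    obtain ⟨i, rfl⟩ := hα.mem_rootSet.1 hx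
    rw [hρ, h, Perm.one_apply]
  · intro h i
    exact hinj ((hρ σ i).symm.trans (h _ (hα.mem_rootSet.2 ⟨i, rfl⟩)))

lemma exists_isGaloisDatum [Infinite M] {a b a' b' : M}
    (hsep : (quartic a b).Separable) (hsep' : (quartic a' b').Separable)
    (hirr : Irreducible (quartic a b)) (hirr' : Irreducible (quartic a' b'))
    (hα : IsRootOrdering a b α) (hβ : IsRootOrdering a' b' β) :
    ∃ k k' S, IsGaloisDatum (quartic a b) (quartic a' b') α β k k' S := by
  classical
  obtain ⟨ρ, hρ⟩ := hα.exists_hom hsep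
  obtain ⟨ρ', hρ'⟩ := hβ.exists_hom hsep'
  have hαi := hα.injective hsep
  have hβi := hβ.injective hsep'
  obtain ⟨k, hk⟩ := exists_range_eq_subgroup hirr hα hαi hρ
  obtain ⟨k', hk'⟩ := exists_range_eq_subgroup hirr' hβ hβi hρ'
  have h1 := hom_eq_one_iff hα hαi hρ
  have h2 := hom_eq_one_iff hβ hβi hρ'
  have h3 : ∀ σ, ρ.prod ρ' σ = 1 ↔
      ∀ x ∈ (quartic a b * quartic a' b').rootSet (AlgebraicClosure M), σ x = x := by
    intro σ
    rw [rootSet, aroots_mul (mul_ne_zero hsep.ne_zero hsep'.ne_zero), Multiset.toFinset_add,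
      Finset.coe_union, MonoidHom.prod_apply, Prod.mk_eq_one, h1, h2]
    exact ⟨fun h x hx => hx.elim (h.1 x) (h.2 x),
      fun h => ⟨fun x hx => h x (Or.inl hx), fun x hx => h x (Or.inr hx)⟩⟩
  refine ⟨k, k', (ρ.prod ρ').range,
    { map_fst := ?_
      map_snd := ?_
      gal_fst := hk ▸ nonempty_gal_mulEquiv_range _ ρ h1
      gal_snd := hk' ▸ nonempty_gal_mulEquiv_range _ ρ' h2
      gal_mul := nonempty_gal_mulEquiv_range _ _ h3
      separable_fst := hsep
      separable_snd := hsep'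
      inner_iff := fun hS hP h0 => ?_
      outer_iff := fun hS hP h0 => ?_ }⟩
  · rw [MonoidHom.map_range, MonoidHom.fst_comp_prod, hk]
  · rw [MonoidHom.map_range, MonoidHom.snd_comp_prod, hk']
  · exact hasDecompositionType_iff hαi hβi (hα.isSeparable hsep) (hβ.isSeparable hsep') hρ hρ'
      le_rfl h0 (hP.inner hS)
  · refine hasDecompositionType_iff hαi hβi (hα.isSeparable hsep) (hβ.isSeparable hsep') hρ hρ'
      le_top h0 ?_
    rw [← hP.outer hS]
    simp

end Tables

end QuarticInt

theorem theorem4p8 {M : Type*} [Field M] [Infinite M] (h2 : (2 : M) ≠ 0)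
    (a b a' b' : M)
    (hsep : (QuarticInt.quartic a b).Separable) (hsep' : (QuarticInt.quartic a' b').Separable)
    (hirr : Irreducible (QuarticInt.quartic a b)) (hirr' : Irreducible (QuarticInt.quartic a' b'))
    (hcard : Nat.card (QuarticInt.quartic a' b').Gal ≤ Nat.card (QuarticInt.quartic a b).Gal)
    (α β : Fin 4 → AlgebraicClosure M)
    (hα : QuarticInt.IsRootOrdering a b α) (hβ : QuarticInt.IsRootOrdering a' b' β) :
    (Nonempty ((QuarticInt.quartic a b).Gal ≃* QuarticInt.D4) ∨
      Nonempty ((QuarticInt.quartic a b).Gal ≃* QuarticInt.C4) ∨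
      Nonempty ((QuarticInt.quartic a b).Gal ≃* QuarticInt.V4)) ∧
    (Nonempty ((QuarticInt.quartic a b).Gal ≃* QuarticInt.D4) →
      QuarticInt.TableD4 (QuarticInt.quartic a b) (QuarticInt.quartic a' b') α β) ∧
    (Nonempty ((QuarticInt.quartic a b).Gal ≃* QuarticInt.C4) ∨
      Nonempty ((QuarticInt.quartic a b).Gal ≃* QuarticInt.V4) →
      QuarticInt.TableC4V4 (QuarticInt.quartic a b) (QuarticInt.quartic a' b') α β) := by
  open QuarticInt in
  obtain ⟨k, k', S, h⟩ := exists_isGaloisDatum hsep hsep' hirr hirr' hα hβ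
  obtain ⟨g⟩ := h.gal_fst
  obtain ⟨g'⟩ := h.gal_snd
  have hc : Nat.card (quartic a b).Gal = elts.countP k.mem := by
    rw [Nat.card_congr g.toEquiv, Kind.card_subgroup]
  have hc' : Nat.card (quartic a' b').Gal = elts.countP k'.mem := by
    rw [Nat.card_congr g'.toEquiv, Kind.card_subgroup]
  -- The inequality of orders excludes the dihedral kind for the second quartic once the first group
  -- has order four.
  have card4 : Nat.card (quartic a b).Gal = 4 → TableC4V4 (quartic a b) (quartic a' b') α β := by
    intro h4
    rw [hc'] at hcard
    refine h.tableC4V4 ?_ ?_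
    · rintro rfl
      exact absurd (hc.symm.trans h4) (by decide)
    · rintro rfl
      rw [h4] at hcard
      exact absurd hcard (by decide)
  refine ⟨?_, ?_, ?_⟩
  · cases k with
    | dih => exact Or.inl (Kind.hasType_dih.map g.trans)
    | cyc => exact Or.inr (Or.inl (Kind.hasType_cyc.map g.trans))
    | klein => exact Or.inr (Or.inr (Kind.hasType_klein.map g.trans))
  · rintro ⟨e⟩
    -- The order alone singles out the dihedral kind, the other two having order four.
    have h8 : Nat.card (quartic a b).Gal = 8 := by
      rw [Nat.card_congr e.toEquiv, Nat.card_eq_fintype_card]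
      decide
    cases k with
    | dih => exact h.tableD4
    | cyc => exact absurd (hc.symm.trans h8) (by decide)
    | klein => exact absurd (hc.symm.trans h8) (by decide)
  · rintro (⟨⟨e⟩⟩ | ⟨⟨e⟩⟩)
    · refine card4 ?_
      rw [Nat.card_congr e.toEquiv, Nat.card_eq_fintype_card]
      decide
    · refine card4 ?_
      rw [Nat.card_congr e.toEquiv, Nat.card_eq_fintype_card]
      decide
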